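/- Let $\mathfrak g$ be a compact simple real Lie algebra (i.e. a simple Lie algebra over $\mathbb R$ whose Killing form $K$ is negative definite) with $\dim\mathfrak g\ge 8$. Equip $\mathfrak g$ with the inner product $\langle\cdot,\cdot\rangle=-K$ and the exterior powers $\Lambda^k(\mathfrak g)$ and tensor products with the induced inner products and $\mathfrak g$-actions. Let $\omega_{\mathfrak g}\in\Lambda^3(\mathfrak g)$ be the Cartan 3-form, $\omega_{\mathfrak g}(X,Y,Z)=K(X,[Y,Z])$ (forms and multivectors being identified by $\langle\cdot,\cdot\rangle$), and let $\mathfrak g^\perp\subset\Lambda^2(\mathfrak g)$ be the kernel of $\Lambda^2(\mathfrak g)\to\mathfrak g$, $v\wedge w\mapsto[v,w]$. For $\tau\in\Lambda^2(\mathfrak g)\cong\mathfrak{so}(\mathfrak g)$ let $\rho_*(\tau)$ denote the induced action of $\tau$ on $\Lambda^3(\mathfrak g)$, and define linear maps $$D_+:\mathfrak g\otimes\mathfrak g^\perp\to\Lambda^4(\mathfrak g),\quad v\otimes\tau\mapsto v\wedge\rho_*(\tau)(\omega_{\mathfrak g}),\qquad D_-:\mathfrak g\otimes\mathfrak g^\perp\to\Lambda^2(\mathfrak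 g),\quad v\otimes\tau\mapsto v\lrcorner\,\rho_*(\tau)(\omega_{\mathfrak g}).$$ Put $W_{har}=\ker D_+\cap\ker D_-$ and let $W_{har}^\perp(D_\pm)$ be the orthogonal complement of $W_{har}$ in $\ker D_\pm$. Let $d_{\mathfrak g}$ be the antiderivation of degree $1$ of $\Lambda(\mathfrak g)$ with $\langle d_{\mathfrak g}v,x\wedge y\rangle=\langle v,[x,y]\rangle$ for $v,x,y\in\mathfrak g$, let $\delta_{\mathfrak g}$ be its adjoint, and put $\Lambda^3_\delta(\mathfrak g)=\delta_{\mathfrak g}(\Lambda^4(\mathfrak g))$. Then: 1. $W_{har}$ is a $\mathfrak g$-submodule of $\mathfrak g\otimes\mathfrak g^\perp$, and $\mathfrak g\otimes\mathfrak g^\perp=W_{har}\oplus\bigoplus_i V_i$ for finitely many irreducible $\mathfrak g$-submodules $V_i$, each of which is isomorphic to a submodule of $\Lambda^2(\mathfrak g)\oplus\Lambda^4(\mathfrak g)$. 2. $W_{har}^\perp(D_+)$ contains a $\mathfrak g$-module isomorphic to $\mathfrak g^\perp$. 3. $\Lambda^3_\delta(\mathfrak g)$ is a $\mathfrak g$-submodule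 of $\Lambda^3(\mathfrak g)$, and $W_{har}^\perp(D_-)$ contains a $\mathfrak g$-module isomorphic to it. 4. The image of $D_+$ contains $\omega_{\mathfrak g}\wedge\Lambda^1(\mathfrak g)$. 5. $D_-$ is surjective. -/

import Mathlib

open scoped TensorProduct

noncomputable section

namespace CartanForm

/-! ### Derivations and antiderivations of the exterior algebra -/

section Exterior

variable {R M : Type*} [CommRing R] [AddCommGroup M] [Module R M]

open ExteriorAlgebra

/-- The derivation of `Λ(M)` (of degree `0`) that extends the endomorphism `A` of `M`:
`v₁ ∧ ⋯ ∧ vₖ ↦ ∑ᵢ v₁ ∧ ⋯ ∧ A vᵢ ∧ ⋯ ∧ vₖ`. It is defined by the recursion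
`(v ∧ φ) ↦ A v ∧ φ + v ∧ (derivation of φ)`. -/
def derivationExt (A : Module.End R M) : Module.End R (ExteriorAlgebra R M) :=
  CliffordAlgebra.foldr' (0 : QuadraticForm R M)
    (LinearMap.mk₂ R
      (fun (m : M) (p : ExteriorAlgebra R M × ExteriorAlgebra R M) =>
        ι R (A m) * p.1 + ι R m * p.2)
      (fun m m' p => by simp only [map_add, add_mul]; abel)
      (fun c m p => by simp only [map_smul, smul_mul_assoc, smul_add])
      (fun m p q => by simp only [Prod.fst_add, Prod.snd_add, mul_add]; abel)
      (fun c m p => by simp only [Prod.smul_fst, Prod.smul_snd, mul_smul_comm, smul_add]))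
    (fun m x fx => by
      change ι R (A m) * (ι R m * x) + ι R m * (ι R (A m) * x + ι R m * fx) = _
      have h1 : ι R m * (ι R m * fx) = 0 := by rw [← mul_assoc, ι_sq_zero, zero_mul]
      rw [mul_add, h1, add_zero, ← mul_assoc, ← mul_assoc, ← add_mul, ι_add_mul_swap, zero_mul]
      simp) 0

lemma derivationExt_ι_mul (A : Module.End R M) (m : M) (x : ExteriorAlgebra R M) :
    derivationExt A (ι R m * x) = ι R (A m) * x + ι R m * derivationExt A x :=
  CliffordAlgebra.foldr'_ι_mul _ _ _ _ _ _

lemma derivationExt_algebraMap (A : Module.End R M) (r : R) :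
    derivationExt A (algebraMap R _ r) = 0 := by
  refine (CliffordAlgebra.foldr'_algebraMap _ _ _ _ _).trans (smul_zero r)

/-- Induction on elements `v ∧ φ`. -/
lemma exterior_induction {C : ExteriorAlgebra R M → Prop}
    (h0 : ∀ r, C (algebraMap R _ r)) (hadd : ∀ x y, C x → C y → C (x + y))
    (hmul : ∀ m x, C x → C (ι R m * x)) (x : ExteriorAlgebra R M) : C x :=
  CliffordAlgebra.left_induction (Q := (0 : QuadraticForm R M)) (P := C) h0 hadd
    (fun x m h => hmul m x h) x

/-- Induction on elements `v ∧ φ` of a fixed degree. -/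
lemma power_succ_induction {k : ℕ} {C : ExteriorAlgebra R M → Prop}
    (hadd : ∀ x y, C x → C y → C (x + y))
    (hmul : ∀ (m : M), ∀ x ∈ ⋀[R]^k M, C (ι R m * x)) :
    ∀ x ∈ ⋀[R]^(k + 1) M, C x := by
  intro x hx
  rw [exteriorPower, pow_succ'] at hx
  refine Submodule.mul_induction_on hx ?_ hadd
  rintro _ ⟨m, rfl⟩ y hy
  exact hmul m y hy

lemma ι_mul_mem {k : ℕ} (m : M) {x : ExteriorAlgebra R M} (hx : x ∈ ⋀[R]^k M) :
    ι R m * x ∈ ⋀[R]^(k + 1) M := by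
  rw [exteriorPower, pow_succ']
  exact Submodule.mul_mem_mul ⟨m, rfl⟩ hx

lemma mem_power_zero {x : ExteriorAlgebra R M} (hx : x ∈ ⋀[R]^0 M) :
    ∃ r, algebraMap R _ r = x := by
  rw [exteriorPower, pow_zero] at hx
  exact Submodule.mem_one.mp hx

lemma derivationExt_mem (A : Module.End R M) {k : ℕ} :
    ∀ x ∈ ⋀[R]^k M, derivationExt A x ∈ ⋀[R]^k M := by
  induction k with
  | zero =>
    intro x hx
    obtain ⟨r, rfl⟩ := mem_power_zero hx
    rw [derivationExt_algebraMap]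
    exact Submodule.zero_mem _
  | succ k ih =>
    refine power_succ_induction (fun x y hx hy => ?_) (fun m x hx => ?_)
    · rw [map_add]
      exact Submodule.add_mem _ hx hy
    · rw [derivationExt_ι_mul]
      exact Submodule.add_mem _ (ι_mul_mem _ hx) (ι_mul_mem _ (ih x hx))

lemma derivationExt_add (A B : Module.End R M) :
    derivationExt (A + B) = derivationExt A + derivationExt B := by
  refine LinearMap.ext fun x => ?_
  induction x using exterior_induction with
  | h0 r => simp only [LinearMap.add_apply, derivationExt_algebraMap, add_zero]
  | hadd x y hx hy => rw [map_add, map_add, hx, hy]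
  | hmul m x hx =>
    rw [LinearMap.add_apply, derivationExt_ι_mul, derivationExt_ι_mul, derivationExt_ι_mul, hx,
      LinearMap.add_apply, LinearMap.add_apply, map_add, add_mul, mul_add]
    abel

lemma derivationExt_smul (c : R) (A : Module.End R M) :
    derivationExt (c • A) = c • derivationExt A := by
  refine LinearMap.ext fun x => ?_
  induction x using exterior_induction with
  | h0 r => simp only [LinearMap.smul_apply, derivationExt_algebraMap, smul_zero]
  | hadd x y hx hy => rw [map_add, map_add, hx, hy]
  | hmul m x hx =>
    rw [LinearMap.smul_apply, derivationExt_ι_mul, derivationExt_ι_mul, hx,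
      LinearMap.smul_apply, LinearMap.smul_apply, map_smul, smul_mul_assoc, mul_smul_comm, smul_add]

lemma derivationExt_lie (A B : Module.End R M) :
    derivationExt (A * B - B * A) =
      derivationExt A * derivationExt B - derivationExt B * derivationExt A := by
  refine LinearMap.ext fun x => ?_
  induction x using exterior_induction with
  | h0 r => simp only [LinearMap.sub_apply, Module.End.mul_apply,
      derivationExt_algebraMap, map_zero, sub_zero]
  | hadd x y hx hy => rw [map_add, map_add, hx, hy]
  | hmul m x hx =>
    simp only [LinearMap.sub_apply, Module.End.mul_apply] at hx ⊢
    simp only [derivationExt_ι_mul, map_add, hx, map_sub, LinearMap.sub_apply,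
      Module.End.mul_apply, mul_sub, sub_mul]
    abel

/-- The action of `A ∈ End(M)` on `Λᵏ(M)` induced from its action on `M`, i.e. the differential of
the natural representation of `GL(M)` on `Λᵏ(M)`. -/
def powerAction (k : ℕ) : Module.End R M →ₗ[R] Module.End R (⋀[R]^k M) where
  toFun A := (derivationExt A).restrict (derivationExt_mem A)
  map_add' A B := by
    ext x
    simp [derivationExt_add]
  map_smul' c A := by
    ext x
    simp [derivationExt_smul]

@[simp] lemma powerAction_coe (k : ℕ) (A : Module.End R M) (x : ⋀[R]^k M) :
    (powerAction k A x : ExteriorAlgebra R M) = derivationExt A x := rfl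

/-- If `M` is a module over the Lie algebra `L`, so is `Λᵏ(M)`. -/
instance powerLieRingModule {L : Type*} [LieRing L] [LieAlgebra R L] [LieRingModule L M]
    [LieModule R L M] (k : ℕ) : LieRingModule L (⋀[R]^k M) where
  bracket x φ := powerAction k (LieModule.toEnd R L M x) φ
  add_lie x y φ := by
    change powerAction k _ φ = powerAction k _ φ + powerAction k _ φ
    rw [map_add, map_add, LinearMap.add_apply]
  lie_add x φ ψ := map_add _ φ ψ
  leibniz_lie x y φ := by
    apply Subtype.ext
    change derivationExt _ (derivationExt _ (φ : ExteriorAlgebra R M)) =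
      derivationExt _ (φ : ExteriorAlgebra R M) + derivationExt _ (derivationExt _ (φ : ExteriorAlgebra R M))
    have h : LieModule.toEnd R L M ⁅x, y⁆ =
        LieModule.toEnd R L M x * LieModule.toEnd R L M y -
          LieModule.toEnd R L M y * LieModule.toEnd R L M x := by
      ext m
      simp only [LieModule.toEnd_apply_apply, LinearMap.sub_apply, Module.End.mul_apply, lie_lie]
    rw [h, derivationExt_lie, LinearMap.sub_apply, Module.End.mul_apply,
      Module.End.mul_apply, sub_add_cancel]

lemma lie_power_def {L : Type*} [LieRing L] [LieAlgebra R L] [LieRingModule L M]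
    [LieModule R L M] (k : ℕ) (x : L) (φ : ⋀[R]^k M) :
    ⁅x, φ⁆ = powerAction k (LieModule.toEnd R L M x) φ := rfl

instance powerLieModule {L : Type*} [LieRing L] [LieAlgebra R L] [LieRingModule L M]
    [LieModule R L M] (k : ℕ) : LieModule R L (⋀[R]^k M) where
  smul_lie c x φ := by
    rw [lie_power_def, lie_power_def, map_smul, map_smul, LinearMap.smul_apply]
  lie_smul c x φ := by
    rw [lie_power_def, lie_power_def, map_smul]

/-- The wedge product `Λʲ(M) × Λᵏ(M) → Λʲ⁺ᵏ(M)`. -/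
def wedge (j k : ℕ) : ⋀[R]^j M →ₗ[R] ⋀[R]^k M →ₗ[R] ⋀[R]^(j + k) M :=
  LinearMap.mk₂ R (fun x y => ⟨(x : ExteriorAlgebra R M) * y, SetLike.mul_mem_graded x.2 y.2⟩)
    (fun _ _ _ => Subtype.ext (add_mul _ _ _))
    (fun _ _ _ => Subtype.ext (smul_mul_assoc _ _ _))
    (fun _ _ _ => Subtype.ext (mul_add _ _ _))
    (fun _ _ _ => Subtype.ext (mul_smul_comm _ _ _))

/-- The wedge product `v ∧ φ` with a vector. -/
def wedgeVec (k : ℕ) : M →ₗ[R] ⋀[R]^k M →ₗ[R] ⋀[R]^(k + 1) M :=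
  LinearMap.mk₂ R (fun m x => ⟨ι R m * x, ι_mul_mem m x.2⟩)
    (fun _ _ _ => Subtype.ext (by simp only [map_add, add_mul, Submodule.coe_add]))
    (fun _ _ _ => Subtype.ext (by simp only [map_smul, smul_mul_assoc, Submodule.coe_smul]))
    (fun _ _ _ => Subtype.ext (mul_add _ _ _))
    (fun _ _ _ => Subtype.ext (mul_smul_comm _ _ _))

lemma contract_mem (a : Module.Dual R M) {k : ℕ} : ∀ x ∈ ⋀[R]^(k + 1) M,
    (CliffordAlgebra.contractLeft (Q := (0 : QuadraticForm R M)) a x : ExteriorAlgebra R M) ∈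
      ⋀[R]^k M := by
  induction k with
  | zero =>
    refine power_succ_induction (fun x y hx hy => ?_) (fun m x hx => ?_)
    · rw [map_add]
      exact Submodule.add_mem _ hx hy
    · obtain ⟨r, rfl⟩ := mem_power_zero hx
      erw [CliffordAlgebra.contractLeft_ι_mul, CliffordAlgebra.contractLeft_algebraMap]
      rw [mul_zero, sub_zero]
      exact Submodule.smul_mem _ _ hx
  | succ k ih =>
    refine power_succ_induction (fun x y hx hy => ?_) (fun m x hx => ?_)
    · rw [map_add]
      exact Submodule.add_mem _ hx hy
    · erw [CliffordAlgebra.contractLeft_ι_mul]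
      exact Submodule.sub_mem _ (Submodule.smul_mem _ _ hx) (ι_mul_mem _ (ih x hx))

/-- The interior product `a ⌟ φ` of a covector `a` with `φ ∈ Λᵏ⁺¹(M)`. -/
def contract (k : ℕ) : Module.Dual R M →ₗ[R] ⋀[R]^(k + 1) M →ₗ[R] ⋀[R]^k M :=
  LinearMap.mk₂ R
    (fun a x => ⟨CliffordAlgebra.contractLeft (Q := (0 : QuadraticForm R M)) a x,
      contract_mem a x x.2⟩)
    (fun _ _ _ => Subtype.ext (by simp only [map_add, LinearMap.add_apply, Submodule.coe_add]))
    (fun _ _ _ => Subtype.ext (by simp only [map_smul, LinearMap.smul_apply, Submodule.coe_smul]))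
    (fun _ _ _ => Subtype.ext (map_add _ _ _))
    (fun _ _ _ => Subtype.ext (map_smul _ _ _))

/-- Elements of degree two commute with vectors. -/
lemma two_mul_ι (y : ⋀[R]^2 M) (m : M) :
    (y : ExteriorAlgebra R M) * ι R m = ι R m * y := by
  obtain ⟨y, hy⟩ := y
  change y * ι R m = ι R m * y
  revert y
  refine power_succ_induction (k := 1) (fun x y hx hy => ?_) (fun a x hx => ?_)
  · rw [add_mul, mul_add, hx, hy]
  · rw [exteriorPower, pow_one] at hx
    obtain ⟨b, rfl⟩ := hx
    have h1 : ι R b * ι R m = -(ι R m * ι R b) := eq_neg_of_add_eq_zero_left (ι_add_mul_swap b m)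
    have h2 : ι R a * ι R m = -(ι R m * ι R a) := eq_neg_of_add_eq_zero_left (ι_add_mul_swap a m)
    rw [mul_assoc, h1, mul_neg, ← mul_assoc, h2, neg_mul, neg_neg, mul_assoc]

/-- The antiderivation of `Λ(M)` (of degree `1`) that extends `D : M → Λ²(M)`. It is defined by the
recursion `(v ∧ φ) ↦ D v ∧ φ - v ∧ (antiderivation of φ)`. -/
def antiderivationExt (D : M →ₗ[R] ⋀[R]^2 M) : Module.End R (ExteriorAlgebra R M) :=
  CliffordAlgebra.foldr' (0 : QuadraticForm R M)
    (LinearMap.mk₂ R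
      (fun (m : M) (p : ExteriorAlgebra R M × ExteriorAlgebra R M) =>
        (D m : ExteriorAlgebra R M) * p.1 - ι R m * p.2)
      (fun m m' p => by simp only [map_add, Submodule.coe_add, add_mul]; abel)
      (fun c m p => by simp only [map_smul, Submodule.coe_smul, smul_mul_assoc, smul_sub])
      (fun m p q => by simp only [Prod.fst_add, Prod.snd_add, mul_add]; abel)
      (fun c m p => by simp only [Prod.smul_fst, Prod.smul_snd, mul_smul_comm, smul_sub]))
    (fun m x fx => by
      change (D m : ExteriorAlgebra R M) * (ι R m * x) -
        ι R m * ((D m : ExteriorAlgebra R M) * x - ι R m * fx) = _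
      have h1 : ι R m * (ι R m * fx) = 0 := by rw [← mul_assoc, ι_sq_zero, zero_mul]
      rw [mul_sub, h1, sub_zero, ← mul_assoc, ← mul_assoc, two_mul_ι, sub_self]
      simp) 0

lemma antiderivationExt_ι_mul (D : M →ₗ[R] ⋀[R]^2 M) (m : M) (x : ExteriorAlgebra R M) :
    antiderivationExt D (ι R m * x) =
      (D m : ExteriorAlgebra R M) * x - ι R m * antiderivationExt D x :=
  CliffordAlgebra.foldr'_ι_mul _ _ _ _ _ _

lemma antiderivationExt_algebraMap (D : M →ₗ[R] ⋀[R]^2 M) (r : R) :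
    antiderivationExt D (algebraMap R _ r) = 0 := by
  refine (CliffordAlgebra.foldr'_algebraMap _ _ _ _ _).trans (smul_zero r)

lemma antiderivationExt_mem (D : M →ₗ[R] ⋀[R]^2 M) {k : ℕ} :
    ∀ x ∈ ⋀[R]^k M, antiderivationExt D x ∈ ⋀[R]^(k + 1) M := by
  induction k with
  | zero =>
    intro x hx
    obtain ⟨r, rfl⟩ := mem_power_zero hx
    rw [antiderivationExt_algebraMap]
    exact Submodule.zero_mem _
  | succ k ih =>
    refine power_succ_induction (fun x y hx hy => ?_) (fun m x hx => ?_)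
    · rw [map_add]
      exact Submodule.add_mem _ hx hy
    · rw [antiderivationExt_ι_mul]
      refine Submodule.sub_mem _ ?_ (ι_mul_mem _ (ih x hx))
      have h := SetLike.mul_mem_graded (A := fun i : ℕ => ⋀[R]^i M) (D m).2 hx
      rwa [show k + 1 + 1 = 2 + k by omega]

end Exterior

/-- The direct sum `M ⊕ N` of two modules over a Lie algebra. -/
instance prodLieRingModule {L M N : Type*} [LieRing L] [AddCommGroup M] [AddCommGroup N]
    [LieRingModule L M] [LieRingModule L N] : LieRingModule L (M × N) where
  bracket x p := (⁅x, p.1⁆, ⁅x, p.2⁆)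
  add_lie _ _ _ := Prod.ext (add_lie _ _ _) (add_lie _ _ _)
  lie_add _ _ _ := Prod.ext (lie_add _ _ _) (lie_add _ _ _)
  leibniz_lie _ _ _ := Prod.ext (leibniz_lie _ _ _) (leibniz_lie _ _ _)

instance prodLieModule {R L M N : Type*} [CommRing R] [LieRing L] [LieAlgebra R L]
    [AddCommGroup M] [AddCommGroup N] [Module R M] [Module R N] [LieRingModule L M]
    [LieRingModule L N] [LieModule R L M] [LieModule R L N] : LieModule R L (M × N) where
  smul_lie _ _ _ := Prod.ext (smul_lie _ _ _) (smul_lie _ _ _)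
  lie_smul _ _ _ := Prod.ext (lie_smul _ _ _) (lie_smul _ _ _)

/-! ### Metrics -/

section Metric

variable (g : Type*) [LieRing g] [LieAlgebra ℝ g]

/-- The metric on `g`: minus the Killing form. -/
def metric : LinearMap.BilinForm ℝ g := -killingForm ℝ g

/-- The metric on `Λᵏ(g)` induced from the metric on `g`:
`⟨v₁ ∧ ⋯ ∧ vₖ, w₁ ∧ ⋯ ∧ wₖ⟩ = det ⟨vᵢ, wⱼ⟩`. -/
def powerMetric (k : ℕ) : LinearMap.BilinForm ℝ (⋀[ℝ]^k g) :=
  exteriorPower.pairingDual ℝ g k ∘ₗ exteriorPower.map k (metric g)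

variable {g} in
lemma powerMetric_apply {k : ℕ} (v w : Fin k → g) :
    powerMetric g k (exteriorPower.ιMulti ℝ k v) (exteriorPower.ιMulti ℝ k w) =
      Matrix.det (Matrix.of fun i j => metric g (v j) (w i)) := by
  simp [powerMetric]

lemma metric_symm (x y : g) : metric g x y = metric g y x := by
  simp only [metric, LinearMap.neg_apply, LieModule.traceForm_comm ℝ g g x y]

lemma powerMetric_symm (k : ℕ) (x y : ⋀[ℝ]^k g) :
    powerMetric g k x y = powerMetric g k y x := by
  have h : LinearMap.flip (powerMetric g k) = powerMetric g k := by
    apply exteriorPower.linearMap_ext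
    ext v w
    simp only [LinearMap.compAlternatingMap_apply, LinearMap.flip_apply, powerMetric_apply]
    rw [← Matrix.det_transpose]
    congr 1
    ext i j
    exact metric_symm g _ _
  exact LinearMap.congr_fun (LinearMap.congr_fun h y) x

lemma metric_nondegenerate [LieAlgebra.IsKilling ℝ g] : (metric g).Nondegenerate := by
  have h := LieAlgebra.IsKilling.killingForm_nondegenerate ℝ g
  refine ⟨fun x hx => h.1 x fun y => ?_, fun y hy => h.2 y fun x => ?_⟩
  · exact neg_eq_zero.mp (hx y)
  · exact neg_eq_zero.mp (hy x)

variable [FiniteDimensional ℝ g] [LieAlgebra.IsKilling ℝ g]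

lemma powerMetric_nondegenerate (k : ℕ) : (powerMetric g k).Nondegenerate := by
  have hsep : (powerMetric g k).SeparatingLeft := by
    intro x hx
    have hinj : Function.Injective (exteriorPower.map k (metric g)) :=
      exteriorPower.map_injective_field
        ((metric g).toDual (metric_nondegenerate g)).injective
    apply hinj
    rw [map_zero]
    let b := Module.finBasis ℝ g
    refine (b.dualBasis.exteriorPower k).ext_elem fun s => ?_
    have key : ∀ y : ⋀[ℝ]^k (Module.Dual ℝ g), (b.dualBasis.exteriorPower k).repr y s =
        exteriorPower.pairingDual ℝ g k y (exteriorPower.ιMulti_family ℝ k b s) := by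
      intro y
      have hy : (b.dualBasis.exteriorPower k).coord s =
          (exteriorPower.pairingDual ℝ g k).flip (exteriorPower.ιMulti_family ℝ k b s) := by
        refine (b.dualBasis.exteriorPower k).ext fun t => ?_
        have ht : exteriorPower.pairingDual ℝ g k
            (exteriorPower.ιMulti_family ℝ k b.dualBasis t) = exteriorPower.ιMultiDual ℝ k b t := by
          rw [Module.Basis.coe_dualBasis]
          rfl
        rw [Module.Basis.coord_apply, Module.Basis.repr_self, exteriorPower.basis_apply,
          LinearMap.flip_apply, ht]
        by_cases hst : t = s
        · rw [hst, Finsupp.single_eq_same, exteriorPower.ιMultiDual_apply_diag]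
        · rw [Finsupp.single_eq_of_ne (Ne.symm hst), exteriorPower.ιMultiDual_apply_nondiag _ _ _ _ _ hst]
      exact LinearMap.congr_fun hy y
    rw [key, map_zero, Finsupp.zero_apply]
    exact hx _
  have hrefl : (powerMetric g k).IsRefl := fun x y h => by rwa [powerMetric_symm]
  exact hrefl.nondegenerate_iff_separatingLeft.mpr hsep

end Metric

/-! ### The Cartan 3-form and the operators `D₊`, `D₋` -/

section Cartan

variable (g : Type*) [LieRing g] [LieAlgebra ℝ g]

/-- The bracket `Λ²(g) → g`, `v ∧ w ↦ [v, w]`. -/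
def bracketMap : ⋀[ℝ]^2 g →ₗ[ℝ] g :=
  exteriorPower.alternatingMapLinearEquiv
    { MultilinearMap.mk' (fun v : Fin 2 → g => ⁅v 0, v 1⁆)
        (fun v i x y => by fin_cases i <;> simp)
        (fun v i c x => by fin_cases i <;> simp) with
      map_eq_zero_of_eq' := fun v i j h hij => by
        fin_cases i <;> fin_cases j <;> simp_all }

lemma bracketMap_apply (v : Fin 2 → g) :
    bracketMap g (exteriorPower.ιMulti ℝ 2 v) = ⁅v 0, v 1⁆ :=
  exteriorPower.alternatingMapLinearEquiv_apply_ιMulti _ _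

/-- The Cartan form as an alternating form, `(X, Y, Z) ↦ K(X, [Y, Z])`, with `K` the Killing
form. -/
def cartanAlternating : g [⋀^Fin 3]→ₗ[ℝ] ℝ :=
  { MultilinearMap.mk' (fun v : Fin 3 → g => killingForm ℝ g (v 0) ⁅v 1, v 2⁆)
      (fun v i x y => by fin_cases i <;> simp)
      (fun v i c x => by fin_cases i <;> simp) with
    map_eq_zero_of_eq' := fun v i j h hij => by
      change killingForm ℝ g (v 0) ⁅v 1, v 2⁆ = 0
      have h01 : v 0 = v 1 → killingForm ℝ g (v 0) ⁅v 1, v 2⁆ = 0 := fun h => by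
        rw [h, ← LieModule.traceForm_apply_lie_apply, lie_self, map_zero, LinearMap.zero_apply]
      have h12 : v 1 = v 2 → killingForm ℝ g (v 0) ⁅v 1, v 2⁆ = 0 := fun h => by
        rw [h, lie_self, map_zero]
      have h02 : v 0 = v 2 → killingForm ℝ g (v 0) ⁅v 1, v 2⁆ = 0 := fun h => by
        rw [h, ← lie_skew, map_neg, ← LieModule.traceForm_apply_lie_apply, lie_self, map_zero,
          LinearMap.zero_apply, neg_zero]
      fin_cases i <;> fin_cases j <;> first | exact absurd rfl hij | skip
      exacts [h01 h, h02 h, h01 h.symm, h12 h, h02 h.symm, h12 h.symm] }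

lemma bracketMap_lie (x : g) (τ : ⋀[ℝ]^2 g) : bracketMap g ⁅x, τ⁆ = ⁅x, bracketMap g τ⁆ := by
  have h : bracketMap g ∘ₗ powerAction 2 (LieModule.toEnd ℝ g g x) =
      LieModule.toEnd ℝ g g x ∘ₗ bracketMap g := by
    apply exteriorPower.linearMap_ext
    ext v
    have hv : powerAction 2 (LieModule.toEnd ℝ g g x) (exteriorPower.ιMulti ℝ 2 v) =
        exteriorPower.ιMulti ℝ 2 ![⁅x, v 0⁆, v 1] + exteriorPower.ιMulti ℝ 2 ![v 0, ⁅x, v 1⁆] := by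
      apply Subtype.ext
      have e : derivationExt (LieModule.toEnd ℝ g g x) (ExteriorAlgebra.ι ℝ (v 1)) =
          ExteriorAlgebra.ι ℝ ⁅x, v 1⁆ := by
        have := derivationExt_ι_mul (LieModule.toEnd ℝ g g x) (v 1) (algebraMap ℝ _ 1)
        rw [derivationExt_algebraMap, mul_zero, add_zero, map_one, mul_one, mul_one] at this
        exact this
      have e' : ∀ a b : g, ExteriorAlgebra.ιMulti ℝ 2 ![a, b] =
          ExteriorAlgebra.ι ℝ a * ExteriorAlgebra.ι ℝ b := fun a b => by
        simp [ExteriorAlgebra.ιMulti_apply]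
      have hv' : v = ![v 0, v 1] := by
        ext i
        fin_cases i <;> rfl
      rw [powerAction_coe, Submodule.coe_add, exteriorPower.ιMulti_apply_coe,
        exteriorPower.ιMulti_apply_coe, exteriorPower.ιMulti_apply_coe, e', e', hv', e',
        derivationExt_ι_mul]
      exact congrArg _ (congrArg _ e)
    simp only [LinearMap.compAlternatingMap_apply, LinearMap.comp_apply, hv, map_add,
      bracketMap_apply, LieModule.toEnd_apply_apply]
    simp
  exact LinearMap.congr_fun h τ

/-- The submodule `g^⊥ = ker (Λ²(g) → g)` of the `g`-module `Λ²(g)`. -/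
def gPerp : LieSubmodule ℝ g (⋀[ℝ]^2 g) :=
  { LinearMap.ker (bracketMap g) with
    lie_mem := fun {x τ} (hτ : bracketMap g τ = 0) => by
      change bracketMap g ⁅x, τ⁆ = 0
      rw [bracketMap_lie, hτ, lie_zero] }

/-- The identification `Λ²(g) → so(g) ⊂ End(g)`: the bivector `u ∧ w` is the skew endomorphism
`x ↦ ⟨w, x⟩ u - ⟨u, x⟩ w`. -/
def bivectorEnd : ⋀[ℝ]^2 g →ₗ[ℝ] Module.End ℝ g :=
  -(LinearMap.compRight ℝ (ExteriorAlgebra.ιInv ∘ₗ (⋀[ℝ]^1 g).subtype) ∘ₗ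
    ((contract 1).comp (metric g)).flip)

lemma bivectorEnd_apply (v : Fin 2 → g) (x : g) :
    bivectorEnd g (exteriorPower.ιMulti ℝ 2 v) x =
      metric g (v 1) x • v 0 - metric g (v 0) x • v 1 := by
  have h : bivectorEnd g (exteriorPower.ιMulti ℝ 2 v) x = -ExteriorAlgebra.ιInv
      (CliffordAlgebra.contractLeft (Q := (0 : QuadraticForm ℝ g)) (metric g x)
        (ExteriorAlgebra.ιMulti ℝ 2 v)) := rfl
  have e : ExteriorAlgebra.ιMulti ℝ 2 v = CliffordAlgebra.ι (0 : QuadraticForm ℝ g) (v 0) *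
      CliffordAlgebra.ι (0 : QuadraticForm ℝ g) (v 1) := by
    simp only [ExteriorAlgebra.ιMulti_apply, List.ofFn_succ, List.ofFn_zero, List.prod_cons,
      List.prod_nil, mul_one]
    rfl
  rw [h, e, CliffordAlgebra.contractLeft_ι_mul, CliffordAlgebra.contractLeft_ι]
  have e2 : CliffordAlgebra.ι (0 : QuadraticForm ℝ g) (v 0) *
      algebraMap ℝ (CliffordAlgebra (0 : QuadraticForm ℝ g)) (metric g x (v 1)) =
      metric g x (v 1) • ExteriorAlgebra.ι ℝ (v 0) := by
    rw [← Algebra.commutes, ← Algebra.smul_def]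
  have e3 : CliffordAlgebra.ι (0 : QuadraticForm ℝ g) (v 1) = ExteriorAlgebra.ι ℝ (v 1) := rfl
  rw [e2, e3, map_sub, map_smul, map_smul, ExteriorAlgebra.ι_leftInverse,
    ExteriorAlgebra.ι_leftInverse, neg_sub, metric_symm g x, metric_symm g x]

/-- The metric on `g ⊗ g^⊥`: `⟨v ⊗ τ, w ⊗ σ⟩ = ⟨v, w⟩ ⟨τ, σ⟩`. -/
def tensorMetric : LinearMap.BilinForm ℝ (g ⊗[ℝ] gPerp g) :=
  (metric g).tmul ((powerMetric g 2).restrict (gPerp g).toSubmodule)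

variable [FiniteDimensional ℝ g] [LieAlgebra.IsKilling ℝ g]

/-- The isomorphism `Λᵏ(g)^* ≅ Λᵏ(g)` given by the metric. -/
def sharp (k : ℕ) : Module.Dual ℝ (⋀[ℝ]^k g) ≃ₗ[ℝ] ⋀[ℝ]^k g :=
  ((powerMetric g k).toDual (powerMetric_nondegenerate g k)).symm

lemma powerMetric_sharp (k : ℕ) (f : Module.Dual ℝ (⋀[ℝ]^k g)) (φ : ⋀[ℝ]^k g) :
    powerMetric g k (sharp g k f) φ = f φ :=
  LinearMap.BilinForm.apply_toDual_symm_apply (hB := powerMetric_nondegenerate g k) f φ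

/-- The Cartan 3-form `ω_g`, as an element of `Λ³(g)`. -/
def cartanForm : ⋀[ℝ]^3 g :=
  sharp g 3 (exteriorPower.alternatingMapLinearEquiv (cartanAlternating g))

/-- The map `d_g : g → Λ²(g)`, `⟨d_g v, x ∧ y⟩ = ⟨v, [x, y]⟩`. -/
def dOne : g →ₗ[ℝ] ⋀[ℝ]^2 g :=
  (sharp g 2).toLinearMap ∘ₗ (bracketMap g).dualMap ∘ₗ metric g

lemma dOne_apply (v x y : g) :
    powerMetric g 2 (dOne g v) (exteriorPower.ιMulti ℝ 2 ![x, y]) = metric g v ⁅x, y⁆ := by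
  rw [dOne, LinearMap.comp_apply, LinearEquiv.coe_coe, powerMetric_sharp, LinearMap.comp_apply,
    LinearMap.dualMap_apply, bracketMap_apply]
  rfl

/-- The differential `d_g : Λᵏ(g) → Λᵏ⁺¹(g)`: the antiderivation of `Λ(g)` that extends
`d_g : g → Λ²(g)`. -/
def dG (k : ℕ) : ⋀[ℝ]^k g →ₗ[ℝ] ⋀[ℝ]^(k + 1) g :=
  (antiderivationExt (dOne g)).restrict (antiderivationExt_mem (dOne g))

/-- The adjoint `δ_g : Λᵏ⁺¹(g) → Λᵏ(g)` of `d_g` with respect to the metrics. -/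
def deltaG (k : ℕ) : ⋀[ℝ]^(k + 1) g →ₗ[ℝ] ⋀[ℝ]^k g :=
  (sharp g k).toLinearMap ∘ₗ (dG g k).dualMap ∘ₗ powerMetric g (k + 1)

lemma deltaG_adjoint (k : ℕ) (φ : ⋀[ℝ]^(k + 1) g) (ψ : ⋀[ℝ]^k g) :
    powerMetric g k (deltaG g k φ) ψ = powerMetric g (k + 1) φ (dG g k ψ) :=
  powerMetric_sharp g k _ ψ

/-- `Λ³_δ(g) = δ_g(Λ⁴(g))`. -/
def lambdaThreeDelta : Submodule ℝ (⋀[ℝ]^3 g) := LinearMap.range (deltaG g 3)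

/-- The map `Λ²(g) → Λ³(g)`, `τ ↦ ρ_*(τ) ω_g`. -/
def rhoCartan : ⋀[ℝ]^2 g →ₗ[ℝ] ⋀[ℝ]^3 g :=
  (powerAction 3 ∘ₗ bivectorEnd g).flip (cartanForm g)

/-- `D₊ : g ⊗ g^⊥ → Λ⁴(g)`, `v ⊗ τ ↦ v ∧ ρ_*(τ) ω_g`. -/
def DPlus : g ⊗[ℝ] gPerp g →ₗ[ℝ] ⋀[ℝ]^4 g :=
  TensorProduct.lift ((wedgeVec 3).compl₂ (rhoCartan g ∘ₗ (gPerp g).toSubmodule.subtype))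

/-- `D₋ : g ⊗ g^⊥ → Λ²(g)`, `v ⊗ τ ↦ v ⌟ ρ_*(τ) ω_g`. -/
def DMinus : g ⊗[ℝ] gPerp g →ₗ[ℝ] ⋀[ℝ]^2 g :=
  TensorProduct.lift (((contract 2).comp (metric g)).compl₂
    (rhoCartan g ∘ₗ (gPerp g).toSubmodule.subtype))

/-- `W_har = ker D₊ ∩ ker D₋`. -/
def wHar : Submodule ℝ (g ⊗[ℝ] gPerp g) := LinearMap.ker (DPlus g) ⊓ LinearMap.ker (DMinus g)

/-- The orthogonal complement of `W_har` in `ker D₊`. -/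
def wHarPerpPlus : Submodule ℝ (g ⊗[ℝ] gPerp g) :=
  LinearMap.ker (DPlus g) ⊓ (tensorMetric g).orthogonal (wHar g)

/-- The orthogonal complement of `W_har` in `ker D₋`. -/
def wHarPerpMinus : Submodule ℝ (g ⊗[ℝ] gPerp g) :=
  LinearMap.ker (DMinus g) ⊓ (tensorMetric g).orthogonal (wHar g)

/-- `ω_g ∧ Λ¹(g) ⊂ Λ⁴(g)`. -/
def cartanWedge : Submodule ℝ (⋀[ℝ]^4 g) := LinearMap.range (wedge 3 1 (cartanForm g))

end Cartan

end CartanForm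

end

/-!
Write `L x` for the action of `x ∈ g` on `Λ(g)`, `x ⌟` for the interior product, `d` for the
differential, `δ` for its adjoint, and let `eᵢ` be an orthonormal basis of `g` for `-K`. Everything
rests on a Cartan calculus on `Λ(g)` itself:

* Koszul's formula `∑ᵢ eᵢ ∧ L(eᵢ) φ = -2 d φ` and its adjoint `∑ᵢ eᵢ ⌟ L(eᵢ) φ = 2 δ φ`
  (`sum_ι_mul_lieDerivative`, `extPairing_sum_interior_lieDerivative`);
* Cartan's formula `d (x ⌟ φ) + x ⌟ d φ = -L x φ` (`extDiff_interior`), and `d ∘ d = 0`;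
* `ρ_*(τ) ω = d τ` for every bivector `τ` (`rhoCartan_eq_extDiff`), which follows from
  `x ⌟ ω = -d x`.

Hence `D₊(v ⊗ τ) = v ∧ d τ` and `D₋(v ⊗ τ) = v ⌟ d τ`, and both are equivariant. Moreover `d` is
injective on `g^⊥ = ker δ` (`eq_zero_of_extDiff_eq_zero`), and `δ d = ½` on `g`, so that
`π τ = τ - 2 d δ τ` is the projection of `Λ²(g)` onto `g^⊥`; it satisfies `d (π τ) = d τ`.

The metric on `g ⊗ g^⊥` is an invariant inner product, so `g ⊗ g^⊥` is completely reducible, and any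
submodule that meets `W_har = ker (D₋, D₊)` trivially embeds into `Λ²(g) ⊕ Λ⁴(g)`. The remaining
claims come from explicit elements of `g ⊗ g^⊥`:

* for `τ ∈ g^⊥` and `p = ∑ᵢ eᵢ ⊗ [eᵢ, τ]`, `D₊ p = -2 d d τ = 0` while `D₋ p = 2 δ d τ` vanishes only
  for `τ = 0`;
* for `φ ∈ δ(Λ⁴(g))` and `p = ∑ᵢ eᵢ ⊗ π(eᵢ ⌟ φ)`, `D₋ p = -2 δ φ = 0` while `D₊ p = -2 d φ` vanishes
  only for `φ = 0`;
* for `v ∈ g` and `p = ∑ᵢ eᵢ ⊗ π(eᵢ ∧ v)`, `D₊ p = -3 ω ∧ v` and `D₋ p = (3 - dim g) d v`.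

In the first two cases the maps `τ ↦ p` and `φ ↦ p` are equivariant, and composing them with the
orthogonal projection off `W_har` gives the required embeddings (`exists_equiv_le_orthogonal`). The
first and the third together show that only `0` is orthogonal to the image of `D₋`.
-/

noncomputable section

namespace CartanForm

/-! ### Orthonormal bases of bilinear forms -/

section Orthonormal

variable {V : Type*} [AddCommGroup V] [Module ℝ V] {n : Type*} [DecidableEq n]

/-- The family `v` is orthonormal for the bilinear form `B`. -/
def IsOrthonormal (B : LinearMap.BilinForm ℝ V) (v : n → V) : Prop :=
  ∀ i j, B (v i) (v j) = if i = j then 1 else 0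

lemma exists_isOrthonormal_basis [FiniteDimensional ℝ V] (B : LinearMap.BilinForm ℝ V)
    (hsymm : ∀ x y, B x y = B y x) (hpos : ∀ x, x ≠ 0 → 0 < B x x) :
    ∃ b : Module.Basis (Fin (Module.finrank ℝ V)) ℝ V, IsOrthonormal B b := by
  let core : InnerProductSpace.Core ℝ V :=
    { inner := fun x y => B x y
      conj_inner_symm := fun x y => hsymm y x
      re_inner_nonneg := fun x => by
        by_cases h : x = 0
        · simp [h]
        · exact (hpos x h).le
      add_left := fun x y z => by simp
      smul_left := fun x y r => by simp
      definite := fun x hx => by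
        by_contra h
        exact (hpos x h).ne' hx }
  let _ : NormedAddCommGroup V := core.toNormedAddCommGroup
  let _ : InnerProductSpace ℝ V := InnerProductSpace.ofCore core.toCore
  refine ⟨(stdOrthonormalBasis ℝ V).toBasis, fun i j => ?_⟩
  have h := orthonormal_iff_ite.mp (stdOrthonormalBasis ℝ V).orthonormal i j
  rw [OrthonormalBasis.coe_toBasis]
  exact h

variable [Fintype n] {B : LinearMap.BilinForm ℝ V} {b : Module.Basis n ℝ V}

lemma IsOrthonormal.apply_eq_repr (hb : IsOrthonormal B b) (i : n) (x : V) :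
    B (b i) x = b.repr x i := by
  conv_lhs => rw [← b.sum_repr x]
  rw [map_sum]
  simp only [map_smul, hb i, smul_eq_mul, mul_ite, mul_one, mul_zero, Finset.sum_ite_eq,
    Finset.mem_univ, if_true]

lemma IsOrthonormal.sum_smul (hb : IsOrthonormal B b) (x : V) : ∑ i, B (b i) x • b i = x := by
  simp_rw [hb.apply_eq_repr, b.sum_repr]

lemma IsOrthonormal.sum_mul (hb : IsOrthonormal B b) (x y : V) :
    ∑ i, B (b i) x * B (b i) y = B x y := by
  conv_rhs => rw [← hb.sum_smul x]
  simp

lemma IsOrthonormal.pos (hb : IsOrthonormal B b) {x : V} (hx : x ≠ 0) : 0 < B x x := by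
  rw [← hb.sum_mul]
  obtain ⟨i, hi⟩ : ∃ i, b.repr x i ≠ 0 := by
    by_contra! h
    exact hx (b.ext_elem fun i => by simp [h i])
  refine Finset.sum_pos' (fun j _ => mul_self_nonneg _) ⟨i, Finset.mem_univ i, ?_⟩
  rw [hb.apply_eq_repr]
  exact mul_self_pos.mpr hi

/-- The tensor `∑ᵢ bᵢ ⊗ bᵢ` of an orthonormal basis is invariant under skew endomorphisms. -/
lemma IsOrthonormal.sum_skew {N : Type*} [AddCommGroup N] [Module ℝ N] (hb : IsOrthonormal B b)
    (F : V →ₗ[ℝ] V →ₗ[ℝ] N) (A : Module.End ℝ V)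
    (hA : ∀ x y, B x (A y) = -B y (A x)) :
    ∑ i, (F (A (b i)) (b i) + F (b i) (A (b i))) = 0 := by
  have h1 : ∀ i, F (A (b i)) (b i) = ∑ j, B (b j) (A (b i)) • F (b j) (b i) := fun i => by
    conv_lhs => rw [← hb.sum_smul (A (b i))]
    simp
  have h2 : ∀ i, F (b i) (A (b i)) = ∑ j, B (b j) (A (b i)) • F (b i) (b j) := fun i => by
    conv_lhs => rw [← hb.sum_smul (A (b i))]
    simp
  rw [Finset.sum_add_distrib, Finset.sum_congr rfl fun i _ => h1 i,
    Finset.sum_congr rfl fun i _ => h2 i, Finset.sum_comm, ← Finset.sum_add_distrib]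
  refine Finset.sum_eq_zero fun i _ => ?_
  rw [← Finset.sum_add_distrib]
  refine Finset.sum_eq_zero fun j _ => ?_
  rw [hA (b i) (b j), neg_smul, neg_add_cancel]

end Orthonormal

/-! ### Modules with an invariant inner product -/

section LieModules

variable {L P : Type*} [LieRing L] [AddCommGroup P] [Module ℝ P]
  [LieRingModule L P]

/-- An injective homomorphism of modules is an isomorphism onto its range. -/
def lieEquivRange {N : Type*} [AddCommGroup N] [Module ℝ N] [LieRingModule L N] (f : N →ₗ⁅ℝ,L⁆ P) (hf : Function.Injective f) : N ≃ₗ⁅ℝ,L⁆ f.range :=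
  { LinearEquiv.ofInjective (f : N →ₗ[ℝ] P) hf with
    map_lie' := fun {x n} => Subtype.ext (f.map_lie x n) }

/-- The orthogonal complement of a submodule with respect to an invariant form. -/
def lieOrthogonal (B : LinearMap.BilinForm ℝ P)
    (hinv : ∀ (x : L) (p q : P), B ⁅x, p⁆ q = -B p ⁅x, q⁆) (W : LieSubmodule ℝ L P) :
    LieSubmodule ℝ L P :=
  { B.orthogonal W.toSubmodule with
    lie_mem := fun {x p} hp w hw => by
      have h : B ⁅x, w⁆ p = 0 := hp _ (W.lie_mem hw)
      change B w ⁅x, p⁆ = 0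
      rw [← neg_eq_zero, ← hinv, h] }

lemma isIrreducible_of_isAtom {V : LieSubmodule ℝ L P} (hV : IsAtom V) :
    LieModule.IsIrreducible ℝ L V := by
  have : Nontrivial V := by
    by_contra h
    rw [not_nontrivial_iff_subsingleton] at h
    refine hV.1 ((LieSubmodule.eq_bot_iff V).mpr fun x hx => ?_)
    exact congrArg Subtype.val (h.elim (⟨x, hx⟩ : V) 0)
  refine LieModule.IsIrreducible.mk fun N hN => ?_
  have hle : N.map V.incl ≤ V := by
    rintro _ ⟨x, -, rfl⟩
    exact x.2
  rcases hV.le_iff.mp hle with h | h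
  · refine absurd ((LieSubmodule.eq_bot_iff N).mpr fun x hx => ?_) hN
    have hx' : (x : P) ∈ N.map V.incl := ⟨x, hx, rfl⟩
    rw [h, LieSubmodule.mem_bot] at hx'
    exact Subtype.ext hx'
  · refine eq_top_iff.mpr fun x _ => ?_
    have hx : (x : P) ∈ N.map V.incl := by
      rw [h]
      exact x.2
    obtain ⟨y, hy, hyx⟩ := hx
    exact (Subtype.ext hyx : y = x) ▸ hy

variable [FiniteDimensional ℝ P]

lemma isCompl_lieOrthogonal (B : LinearMap.BilinForm ℝ P) (hsymm : ∀ p q, B p q = B q p)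
    (hpos : ∀ p, p ≠ 0 → 0 < B p p)
    (hinv : ∀ (x : L) (p q : P), B ⁅x, p⁆ q = -B p ⁅x, q⁆) (W : LieSubmodule ℝ L P) :
    IsCompl W (lieOrthogonal B hinv W) := by
  rw [← LieSubmodule.isCompl_toSubmodule]
  have hrefl : B.IsRefl := fun x y h => by rwa [hsymm]
  refine (LinearMap.BilinForm.isCompl_orthogonal_iff_disjoint hrefl).mpr ?_
  rw [Submodule.disjoint_def]
  intro x hx hx'
  by_contra h
  exact (hpos x h).ne' (hx' x hx)

/-- A module with an invariant inner product is the direct sum of any given submodule and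
finitely many irreducible ones. -/
lemma exists_irreducible_decomposition (B : LinearMap.BilinForm ℝ P)
    (hsymm : ∀ p q, B p q = B q p) (hpos : ∀ p, p ≠ 0 → 0 < B p p)
    (hinv : ∀ (x : L) (p q : P), B ⁅x, p⁆ q = -B p ⁅x, q⁆) (W : LieSubmodule ℝ L P) :
    ∃ (m : ℕ) (V : Fin m → LieSubmodule ℝ L P), (∀ i, LieModule.IsIrreducible ℝ L (V i)) ∧
      (∀ i, Disjoint (V i) W) ∧
      DirectSum.IsInternal (fun o : Option (Fin m) =>
          o.elim W.toSubmodule (fun i => (V i).toSubmodule)) := by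
  have : ComplementedLattice (LieSubmodule ℝ L P) :=
    ⟨fun U => ⟨_, isCompl_lieOrthogonal B hsymm hpos hinv U⟩⟩
  have : IsAtomistic (LieSubmodule ℝ L P) := inferInstance
  obtain ⟨s, hs, hW, hatom⟩ := exists_sSupIndep_isCompl_sSup_atoms sSup_atoms_eq_top W
  have hfin : Finite s := WellFoundedGT.finite_of_sSupIndep hs
  obtain ⟨m, ⟨σ⟩⟩ := finite_iff_exists_equiv_fin.mp hfin
  have hV : iSupIndep fun i => (σ.symm i : LieSubmodule ℝ L P) :=
    ((sSupIndep_iff s).mp hs).comp σ.symm.injective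
  have hsup : ⨆ i, (σ.symm i : LieSubmodule ℝ L P) = sSup s := by
    rw [sSup_eq_iSup']
    exact σ.symm.iSup_comp (g := fun a : s => (a : LieSubmodule ℝ L P))
  refine ⟨m, fun i => σ.symm i, fun i => isIrreducible_of_isAtom (hatom (σ.symm i).2),
    fun i => hW.disjoint.symm.mono_left (le_sSup (σ.symm i).2), ?_⟩
  have helim : (fun o : Option (Fin m) => o.elim W.toSubmodule
      fun i => (σ.symm i : LieSubmodule ℝ L P).toSubmodule) =
      fun o : Option (Fin m) => (o.elim W fun i => (σ.symm i : LieSubmodule ℝ L P)).toSubmodule := by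
    funext o
    cases o <;> rfl
  rw [helim, DirectSum.isInternal_submodule_iff_iSupIndep_and_iSup_eq_top,
    LieSubmodule.iSupIndep_toSubmodule, ← LieSubmodule.iSup_toSubmodule,
    ← LieSubmodule.top_toSubmodule (L := L), LieSubmodule.toSubmodule_inj, iSup_option]
  simp only [Option.elim_none, Option.elim_some, hsup]
  refine ⟨?_, hW.sup_eq_top⟩
  rintro (_ | i)
  · refine hW.disjoint.mono_right (iSup₂_le ?_)
    rintro (_ | i) hi
    · exact absurd rfl hi
    · exact le_sSup (σ.symm i).2
  · refine Disjoint.mono_right (iSup₂_le ?_) <|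
      Disjoint.disjoint_sup_right_of_disjoint_sup_left (hV i) (c := W)
        (hW.disjoint.symm.mono_left ?_)
    · rintro (_ | j) hj
      · exact le_sup_right
      · exact le_sup_of_le_left (le_iSup₂_of_le j (fun h => hj (congrArg some h)) le_rfl)
    · exact sup_le (le_sSup (σ.symm i).2) (iSup₂_le fun j _ => le_sSup (σ.symm j).2)

/-- Let `f : N → P` be a homomorphism with values in `K` that takes no nonzero value in the
submodule `W ≤ K`. The orthogonal projection off `W` then embeds `N` into the orthogonal complement
of `W` in `K`. -/
lemma exists_equiv_le_orthogonal {N : Type*} [AddCommGroup N] [Module ℝ N] [LieRingModule L N] (B : LinearMap.BilinForm ℝ P)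
    (hsymm : ∀ p q, B p q = B q p) (hpos : ∀ p, p ≠ 0 → 0 < B p p)
    (hinv : ∀ (x : L) (p q : P), B ⁅x, p⁆ q = -B p ⁅x, q⁆) (W : LieSubmodule ℝ L P)
    (K : Submodule ℝ P) (hWK : W.toSubmodule ≤ K) (f : N →ₗ⁅ℝ,L⁆ P) (hfK : ∀ n, f n ∈ K)
    (hf : ∀ n, f n ∈ W → n = 0) :
    ∃ U : LieSubmodule ℝ L P, U.toSubmodule ≤ K ⊓ B.orthogonal W.toSubmodule ∧
      Nonempty (U ≃ₗ⁅ℝ,L⁆ N) := by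
  have hc := (isCompl_lieOrthogonal B hsymm hpos hinv W).symm
  rw [← LieSubmodule.isCompl_toSubmodule] at hc
  let Q := lieOrthogonal B hinv W
  let π : P →ₗ[ℝ] P := Q.toSubmodule.projection W.toSubmodule hc
  -- the orthogonal projection onto `Q`
  let p : P →ₗ⁅ℝ,L⁆ P :=
    { π with
      map_lie' := fun {x q} => by
        change π ⁅x, q⁆ = ⁅x, π q⁆
        have h1 : π ⁅x, π q⁆ = ⁅x, π q⁆ := Submodule.projection_apply_left hc
          ⟨_, Q.lie_mem (x := x) (Submodule.projection_apply_mem hc q)⟩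
        have h2 : π ⁅x, q - π q⁆ = 0 := Submodule.projection_apply_right hc
          ⟨_, W.lie_mem (x := x) (Submodule.sub_projection_mem hc q)⟩
        rw [lie_sub, map_sub] at h2
        rw [sub_eq_zero.mp h2]
        exact h1 }
  have hpW : ∀ q, q - p q ∈ W := Submodule.sub_projection_mem hc
  have hpQ : ∀ q, p q ∈ B.orthogonal W.toSubmodule := Submodule.projection_apply_mem hc
  let F : N →ₗ⁅ℝ,L⁆ P := p.comp f
  have hF : Function.Injective F := by
    rw [← LieModuleHom.coe_toLinearMap, ← LinearMap.ker_eq_bot]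
    refine LinearMap.ker_eq_bot'.mpr fun n hn => hf n ?_
    have h := hpW (f n)
    rwa [show p (f n) = 0 from hn, sub_zero] at h
  refine ⟨F.range, ?_, ⟨(lieEquivRange F hF).symm⟩⟩
  rintro _ ⟨n, rfl⟩
  refine ⟨?_, hpQ _⟩
  have h := K.sub_mem (hfK n) (hWK (hpW (f n)))
  rwa [sub_sub_cancel] at h

end LieModules

/-! ### The interior product and the pairing of multivectors -/

section Interior

open ExteriorAlgebra

variable {g : Type*} [LieRing g] [LieAlgebra ℝ g]

/-- The interior product `x ⌟ φ` of a vector `x` with a multivector `φ`, vectors being identified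
with covectors by the metric. -/
def interior : g →ₗ[ℝ] Module.End ℝ (ExteriorAlgebra ℝ g) :=
  CliffordAlgebra.contractLeft (Q := (0 : QuadraticForm ℝ g)) ∘ₗ metric g

lemma interior_ι_mul (x v : g) (φ : ExteriorAlgebra ℝ g) :
    interior x (ι ℝ v * φ) = metric g x v • φ - ι ℝ v * interior x φ :=
  CliffordAlgebra.contractLeft_ι_mul _ _ _

lemma interior_algebraMap (x : g) (r : ℝ) : interior x (algebraMap ℝ (ExteriorAlgebra ℝ g) r) = 0 :=
  CliffordAlgebra.contractLeft_algebraMap _ _ _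

lemma interior_ι (x v : g) : interior x (ι ℝ v) = algebraMap ℝ _ (metric g x v) :=
  CliffordAlgebra.contractLeft_ι _ _ _

lemma interior_mem (x : g) {k : ℕ} {φ : ExteriorAlgebra ℝ g} (hφ : φ ∈ ⋀[ℝ]^(k + 1) g) :
    interior x φ ∈ ⋀[ℝ]^k g :=
  contract_mem _ _ hφ

lemma interior_interior (x : g) (φ : ExteriorAlgebra ℝ g) : interior x (interior x φ) = 0 :=
  CliffordAlgebra.contractLeft_contractLeft _ _

/-- The transpose of the interior product, acting on linear forms on `Λ(g)`. -/
def interiorTranspose :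
    g →ₗ[ℝ] Module.Dual ℝ (ExteriorAlgebra ℝ g) →ₗ[ℝ] Module.Dual ℝ (ExteriorAlgebra ℝ g) where
  toFun v := (interior v).dualMap
  map_add' v w := by ext; simp
  map_smul' c v := by ext; simp

lemma interiorTranspose_sq (v : g) (f : Module.Dual ℝ (ExteriorAlgebra ℝ g)) :
    interiorTranspose v (interiorTranspose v f) = (0 : QuadraticForm ℝ g) v • f := by
  refine LinearMap.ext fun φ => ?_
  change f (interior v (interior v φ)) = _
  rw [interior_interior]
  simp

/-- The pairing of multivectors determined by `⟨v ∧ φ, ψ⟩ = ⟨φ, v ⌟ ψ⟩`. It extends the metrics of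
all the `Λᵏ(g)`, see `extPairing_eq_powerMetric`. -/
def extPairing : ExteriorAlgebra ℝ g →ₗ[ℝ] Module.Dual ℝ (ExteriorAlgebra ℝ g) :=
  CliffordAlgebra.foldr (0 : QuadraticForm ℝ g) interiorTranspose interiorTranspose_sq
    (algebraMapInv (R := ℝ) (M := g)).toLinearMap

lemma extPairing_ι_mul (v : g) (φ ψ : ExteriorAlgebra ℝ g) :
    extPairing (ι ℝ v * φ) ψ = extPairing φ (interior v ψ) := by
  have h := CliffordAlgebra.foldr_mul (0 : QuadraticForm ℝ g) interiorTranspose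
    interiorTranspose_sq (algebraMapInv (R := ℝ) (M := g)).toLinearMap (CliffordAlgebra.ι _ v) φ
  rw [CliffordAlgebra.foldr_ι] at h
  exact LinearMap.congr_fun h ψ

lemma extPairing_algebraMap (r s : ℝ) :
    extPairing (algebraMap ℝ (ExteriorAlgebra ℝ g) r) (algebraMap ℝ _ s) = r * s := by
  have h := CliffordAlgebra.foldr_algebraMap (0 : QuadraticForm ℝ g) interiorTranspose
    interiorTranspose_sq (algebraMapInv (R := ℝ) (M := g)).toLinearMap r
  refine (LinearMap.congr_fun h (algebraMap ℝ _ s)).trans ?_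
  rw [LinearMap.smul_apply, smul_eq_mul]
  exact congrArg _ (algebraMap_leftInverse g s)

lemma ιMulti_cons {k : ℕ} (v : Fin (k + 1) → g) :
    ExteriorAlgebra.ιMulti ℝ (k + 1) v = ι ℝ (v 0) * ExteriorAlgebra.ιMulti ℝ k (Fin.tail v) := by
  rw [ExteriorAlgebra.ιMulti_succ_apply]
  rfl

lemma interior_ιMulti {k : ℕ} (x : g) (w : Fin (k + 1) → g) :
    interior x (ExteriorAlgebra.ιMulti ℝ (k + 1) w) =
      ∑ i : Fin (k + 1), ((-1) ^ (i : ℕ) * metric g x (w i)) • ExteriorAlgebra.ιMulti ℝ k (w ∘ i.succAbove) := by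
  induction k with
  | zero =>
    rw [ιMulti_cons]
    simp [interior_ι, Algebra.algebraMap_eq_smul_one]
  | succ k ih =>
    rw [ιMulti_cons, interior_ι_mul, ih, sub_eq_add_neg, Finset.mul_sum,
      ← Finset.sum_neg_distrib]
    refine Eq.trans ?_ (Fin.sum_univ_succ _).symm
    congr 1
    · simp [Fin.tail_def, Function.comp_def]
    · refine Finset.sum_congr rfl fun i _ => ?_
      rw [mul_smul_comm, ← neg_smul, ιMulti_cons (w ∘ i.succ.succAbove)]
      congr 1
      · simp [Fin.tail, pow_succ]
      · simp [Fin.tail_def, Function.comp_def]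

lemma extPairing_ιMulti {k : ℕ} (v w : Fin k → g) :
    extPairing (ExteriorAlgebra.ιMulti ℝ k v) (ExteriorAlgebra.ιMulti ℝ k w) =
      Matrix.det (Matrix.of fun i j => metric g (v i) (w j)) := by
  induction k with
  | zero =>
    simp only [ExteriorAlgebra.ιMulti_zero_apply, Matrix.det_fin_zero]
    simpa using extPairing_algebraMap (g := g) 1 1
  | succ k ih =>
    rw [ιMulti_cons v, extPairing_ι_mul, interior_ιMulti, Matrix.det_succ_row_zero, map_sum]
    refine Finset.sum_congr rfl fun i _ => ?_
    rw [map_smul, ih, smul_eq_mul]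
    rfl

lemma extPairing_eq_powerMetric {k : ℕ} (x y : ⋀[ℝ]^k g) :
    extPairing (x : ExteriorAlgebra ℝ g) (y : ExteriorAlgebra ℝ g) = powerMetric g k x y := by
  have h : (extPairing.compl₂ (⋀[ℝ]^k g).subtype) ∘ₗ (⋀[ℝ]^k g).subtype = powerMetric g k := by
    apply exteriorPower.linearMap_ext
    ext v w
    simp only [LinearMap.compAlternatingMap_apply, powerMetric_apply, LinearMap.comp_apply,
      LinearMap.compl₂_apply, Submodule.subtype_apply, exteriorPower.ιMulti_apply_coe,
      extPairing_ιMulti]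
    rw [← Matrix.det_transpose]
    congr 1
  exact LinearMap.congr_fun (LinearMap.congr_fun h x) y

lemma extPairing_symm {k : ℕ} {φ ψ : ExteriorAlgebra ℝ g} (hφ : φ ∈ ⋀[ℝ]^k g)
    (hψ : ψ ∈ ⋀[ℝ]^k g) : extPairing φ ψ = extPairing ψ φ := by
  have h1 := extPairing_eq_powerMetric (⟨φ, hφ⟩ : ⋀[ℝ]^k g) ⟨ψ, hψ⟩
  have h2 := extPairing_eq_powerMetric (⟨ψ, hψ⟩ : ⋀[ℝ]^k g) ⟨φ, hφ⟩
  exact h1.trans ((powerMetric_symm g k _ _).trans h2.symm)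

lemma extPairing_interior {k : ℕ} (v : g) {φ ψ : ExteriorAlgebra ℝ g}
    (hφ : φ ∈ ⋀[ℝ]^(k + 1) g) (hψ : ψ ∈ ⋀[ℝ]^k g) :
    extPairing (interior v φ) ψ = extPairing φ (ι ℝ v * ψ) := by
  rw [extPairing_symm (interior_mem v hφ) hψ, extPairing_symm hφ (ι_mul_mem v hψ),
    extPairing_ι_mul]

lemma isOrthonormal_powerMetric {n : Type*} [LinearOrder n] [Fintype n]
    {e : Module.Basis n ℝ g} (he : IsOrthonormal (metric g) e) (k : ℕ) :
    IsOrthonormal (powerMetric g k) (e.exteriorPower k) := by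
  have he' : ∀ i, metric g (e i) = e.coord i := fun i => e.ext fun j => by
    rw [he i j, Module.Basis.coord_apply, e.repr_self, Finsupp.single_apply]
    simp only [eq_comm]
  have hmap : ∀ s, exteriorPower.pairingDual ℝ g k (exteriorPower.map k (metric g)
      (exteriorPower.ιMulti_family ℝ k e s)) = exteriorPower.ιMultiDual ℝ k e s := fun s => by
    rw [exteriorPower.ιMultiDual, exteriorPower.ιMulti_family, exteriorPower.map_apply_ιMulti]
    congr 2
    funext i
    exact he' _
  intro s t
  rw [exteriorPower.basis_apply, exteriorPower.basis_apply]
  refine (LinearMap.congr_fun (hmap s) _).trans ?_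
  split_ifs with h
  · rw [h, exteriorPower.ιMultiDual_apply_diag]
  · rw [exteriorPower.ιMultiDual_apply_nondiag _ _ _ _ _ h]

end Interior

/-! ### Lie derivative and differential on the exterior algebra -/

section Calculus

open ExteriorAlgebra

/-- Induction on elements of degree two. -/
lemma power_two_induction {R M : Type*} [CommRing R] [AddCommGroup M] [Module R M]
    {C : ExteriorAlgebra R M → Prop} (hadd : ∀ x y, C x → C y → C (x + y))
    (hmul : ∀ a b : M, C (ι R a * ι R b)) : ∀ x ∈ ⋀[R]^2 M, C x := by
  refine power_succ_induction (k := 1) hadd fun a x hx => ?_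
  rw [exteriorPower, pow_one] at hx
  obtain ⟨b, rfl⟩ := hx
  exact hmul a b

lemma derivationExt_ι {R M : Type*} [CommRing R] [AddCommGroup M] [Module R M]
    (A : Module.End R M) (v : M) : derivationExt A (ι R v) = ι R (A v) := by
  have h := derivationExt_ι_mul A v (algebraMap R _ 1)
  rwa [derivationExt_algebraMap, mul_zero, add_zero, map_one, mul_one, mul_one] at h

lemma derivationExt_mul {R M : Type*} [CommRing R] [AddCommGroup M] [Module R M]
    (A : Module.End R M) (φ ψ : ExteriorAlgebra R M) :
    derivationExt A (φ * ψ) = derivationExt A φ * ψ + φ * derivationExt A ψ := by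
  induction φ using exterior_induction with
  | h0 r =>
    rw [derivationExt_algebraMap, zero_mul, zero_add, ← Algebra.smul_def, ← Algebra.smul_def,
      map_smul]
  | hadd x y hx hy => rw [add_mul, map_add, map_add, hx, hy, add_mul, add_mul]; abel
  | hmul m x hx =>
    rw [mul_assoc, derivationExt_ι_mul, derivationExt_ι_mul, hx]
    simp only [mul_add, add_mul, mul_assoc, add_assoc]

variable {g : Type*} [LieRing g] [LieAlgebra ℝ g]

lemma metric_lie (x y z : g) : metric g ⁅x, y⁆ z = -metric g y ⁅x, z⁆ := by
  simp only [metric, LinearMap.neg_apply, neg_neg]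
  rw [← lie_skew, map_neg, LinearMap.neg_apply, neg_neg]
  exact LieModule.traceForm_apply_lie_apply ℝ g g y x z

lemma metric_lie_right (x y z : g) : metric g y ⁅x, z⁆ = -metric g z ⁅x, y⁆ := by
  rw [metric_symm g z, metric_lie, neg_neg]

/-- The Lie derivative on `Λ(g)`, i.e. the action of `x ∈ g` by derivations extending `ad x`. -/
def lieDerivative (x : g) : Module.End ℝ (ExteriorAlgebra ℝ g) :=
  derivationExt (LieModule.toEnd ℝ g g x)

lemma lieDerivative_ι (x v : g) : lieDerivative x (ι ℝ v) = ι ℝ ⁅x, v⁆ := derivationExt_ι _ _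

lemma lieDerivative_ι_mul (x v : g) (φ : ExteriorAlgebra ℝ g) :
    lieDerivative x (ι ℝ v * φ) = ι ℝ ⁅x, v⁆ * φ + ι ℝ v * lieDerivative x φ :=
  derivationExt_ι_mul _ _ _

lemma lieDerivative_mul (x : g) (φ ψ : ExteriorAlgebra ℝ g) :
    lieDerivative x (φ * ψ) = lieDerivative x φ * ψ + φ * lieDerivative x ψ :=
  derivationExt_mul _ _ _

lemma lieDerivative_algebraMap (x : g) (r : ℝ) :
    lieDerivative x (algebraMap ℝ (ExteriorAlgebra ℝ g) r) = 0 :=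
  derivationExt_algebraMap _ _

lemma lieDerivative_mem (x : g) {k : ℕ} {φ : ExteriorAlgebra ℝ g} (hφ : φ ∈ ⋀[ℝ]^k g) :
    lieDerivative x φ ∈ ⋀[ℝ]^k g :=
  derivationExt_mem _ _ hφ

lemma lieDerivative_interior (x y : g) (φ : ExteriorAlgebra ℝ g) :
    lieDerivative x (interior y φ) = interior ⁅x, y⁆ φ + interior y (lieDerivative x φ) := by
  induction φ using exterior_induction with
  | h0 r => simp only [interior_algebraMap, lieDerivative_algebraMap, map_zero, add_zero]
  | hadd φ ψ h h' => rw [map_add, map_add, map_add, map_add, map_add, h, h']; abel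
  | hmul v φ h =>
    rw [interior_ι_mul, interior_ι_mul, lieDerivative_ι_mul, map_add, interior_ι_mul,
      interior_ι_mul, map_sub, map_smul, lieDerivative_ι_mul, h, metric_lie x y v]
    simp only [mul_add, neg_smul]
    abel

lemma extPairing_algebraMap_ι_mul (r : ℝ) (v : g) (ψ : ExteriorAlgebra ℝ g) :
    extPairing (algebraMap ℝ (ExteriorAlgebra ℝ g) r) (ι ℝ v * ψ) = 0 := by
  have h := CliffordAlgebra.foldr_algebraMap (0 : QuadraticForm ℝ g) interiorTranspose
    interiorTranspose_sq (algebraMapInv (R := ℝ) (M := g)).toLinearMap r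
  refine (LinearMap.congr_fun h (ι ℝ v * ψ)).trans ?_
  rw [LinearMap.smul_apply, AlgHom.toLinearMap_apply, map_mul, algebraMapInv, lift_ι_apply]
  simp

lemma extPairing_lieDerivative (x : g) (φ ψ : ExteriorAlgebra ℝ g) :
    extPairing (lieDerivative x φ) ψ = -extPairing φ (lieDerivative x ψ) := by
  induction φ using exterior_induction generalizing ψ with
  | h0 r =>
    rw [lieDerivative_algebraMap, map_zero, LinearMap.zero_apply, zero_eq_neg]
    induction ψ using exterior_induction with
    | h0 s => rw [lieDerivative_algebraMap, map_zero]
    | hadd φ ψ h h' => rw [map_add, map_add, h, h', add_zero]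
    | hmul v φ h =>
      rw [lieDerivative_ι_mul, map_add, extPairing_algebraMap_ι_mul, extPairing_algebraMap_ι_mul,
        add_zero]
  | hadd φ ψ h h' =>
    simp only [map_add, LinearMap.add_apply, h, h', neg_add]
  | hmul v φ h =>
    rw [lieDerivative_ι_mul, map_add, LinearMap.add_apply, extPairing_ι_mul, extPairing_ι_mul,
      extPairing_ι_mul, h, lieDerivative_interior, map_add]
    abel

/-- The interior product with a vector is an antiderivation; here one factor is of degree two. -/
lemma interior_two_mul (x : g) {τ : ExteriorAlgebra ℝ g} (hτ : τ ∈ ⋀[ℝ]^2 g)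
    (φ : ExteriorAlgebra ℝ g) :
    interior x (τ * φ) = interior x τ * φ + τ * interior x φ := by
  revert τ
  refine @power_two_induction _ _ _ _ _ _ (fun a b ha hb => ?_) fun a b => ?_
  · rw [add_mul, map_add, ha, hb, map_add, add_mul, add_mul]
    abel
  · rw [mul_assoc, interior_ι_mul, interior_ι_mul, interior_ι_mul, interior_ι]
    simp only [sub_mul, mul_sub, smul_mul_assoc, mul_smul_comm, mul_assoc, ← Algebra.smul_def]
    abel

variable [FiniteDimensional ℝ g] [LieAlgebra.IsKilling ℝ g]

/-- The differential `d` on `Λ(g)`. -/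
def extDiff : Module.End ℝ (ExteriorAlgebra ℝ g) := antiderivationExt (dOne g)

lemma extDiff_ι_mul (v : g) (φ : ExteriorAlgebra ℝ g) :
    extDiff (ι ℝ v * φ) = (dOne g v : ExteriorAlgebra ℝ g) * φ - ι ℝ v * extDiff φ :=
  antiderivationExt_ι_mul _ _ _

lemma extDiff_algebraMap (r : ℝ) : extDiff (algebraMap ℝ (ExteriorAlgebra ℝ g) r) = 0 :=
  antiderivationExt_algebraMap _ _

lemma extDiff_ι (v : g) : extDiff (ι ℝ v) = (dOne g v : ExteriorAlgebra ℝ g) := by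
  have h := extDiff_ι_mul v (algebraMap ℝ (ExteriorAlgebra ℝ g) 1)
  rwa [extDiff_algebraMap, mul_zero, sub_zero, map_one, mul_one, mul_one] at h

/-- The differential is an antiderivation; here one factor is of degree two. -/
lemma extDiff_two_mul {τ : ExteriorAlgebra ℝ g} (hτ : τ ∈ ⋀[ℝ]^2 g) (φ : ExteriorAlgebra ℝ g) :
    extDiff (τ * φ) = extDiff τ * φ + τ * extDiff φ := by
  revert τ
  refine @power_two_induction _ _ _ _ _ _ (fun a b ha hb => ?_) fun a b => ?_
  · rw [add_mul, map_add, ha, hb, map_add, add_mul, add_mul]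
    abel
  · rw [mul_assoc, extDiff_ι_mul, extDiff_ι_mul, extDiff_ι_mul, extDiff_ι]
    simp only [sub_mul, mul_sub, mul_assoc]
    abel

lemma powerMetric_dOne (v : g) (τ : ⋀[ℝ]^2 g) :
    powerMetric g 2 (dOne g v) τ = metric g v (bracketMap g τ) :=
  powerMetric_sharp g 2 _ τ

variable {n : Type*} [Fintype n] [DecidableEq n] {e : Module.Basis n ℝ g}

omit [FiniteDimensional ℝ g] [LieAlgebra.IsKilling ℝ g] in
lemma coe_ιMulti_two (a b : g) : (exteriorPower.ιMulti ℝ 2 ![a, b] : ExteriorAlgebra ℝ g) =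
    ι ℝ a * ι ℝ b := by
  simp [ExteriorAlgebra.ιMulti_apply]

/-- Two elements of `Λᵏ(g)` with the same metric pairing against every `x ∧ y` are equal. -/
lemma ext_powerMetric {k : ℕ} {φ ψ : ⋀[ℝ]^k g}
    (h : ∀ v : Fin k → g, powerMetric g k φ (exteriorPower.ιMulti ℝ k v) =
      powerMetric g k ψ (exteriorPower.ιMulti ℝ k v)) : φ = ψ := by
  rw [← sub_eq_zero]
  refine (powerMetric_nondegenerate g k).1 _ fun y => ?_
  have h' : powerMetric g k φ = powerMetric g k ψ := by
    apply exteriorPower.linearMap_ext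
    ext v
    exact h v
  rw [map_sub, h', sub_self, LinearMap.zero_apply]

/-- The explicit form `d v = ½ ∑ᵢ eᵢ ∧ [v, eᵢ]` of the differential. -/
lemma dOne_eq_sum_ιMulti (he : IsOrthonormal (metric g) e) (v : g) :
    dOne g v = (1 / 2 : ℝ) • ∑ i, exteriorPower.ιMulti ℝ 2 ![e i, ⁅v, e i⁆] := by
  refine ext_powerMetric fun w => ?_
  have hs : ∀ i, powerMetric g 2 (exteriorPower.ιMulti ℝ 2 ![e i, ⁅v, e i⁆])
      (exteriorPower.ιMulti ℝ 2 w) = metric g (e i) ⁅v, w 0⁆ * metric g (e i) (w 1) -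
        metric g (e i) (w 0) * metric g (e i) ⁅v, w 1⁆ := fun i => by
    rw [powerMetric_apply, Matrix.det_fin_two]
    simp only [Matrix.of_apply, Matrix.cons_val_zero, Matrix.cons_val_one, metric_lie v (e i)]
    ring
  rw [powerMetric_dOne, bracketMap_apply, map_smul, map_sum]
  simp only [LinearMap.smul_apply, LinearMap.sum_apply, hs, Finset.sum_sub_distrib, he.sum_mul]
  have h1 := metric_lie (w 0) v (w 1)
  rw [← lie_skew, map_neg, LinearMap.neg_apply] at h1
  rw [smul_eq_mul]
  linarith [metric_lie v (w 0) (w 1)]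

lemma dOne_eq_sum (he : IsOrthonormal (metric g) e) (v : g) :
    (dOne g v : ExteriorAlgebra ℝ g) = (1 / 2 : ℝ) • ∑ i, ι ℝ (e i) * ι ℝ ⁅v, e i⁆ := by
  rw [dOne_eq_sum_ιMulti he, Submodule.coe_smul, Submodule.coe_sum]
  simp only [coe_ιMulti_two]

/-- The interior product `x ⌟ d v = [v, x]`. -/
lemma interior_dOne (he : IsOrthonormal (metric g) e) (x v : g) :
    interior x (dOne g v : ExteriorAlgebra ℝ g) = ι ℝ ⁅v, x⁆ := by
  have h1 : ∑ i, metric g x (e i) • ι ℝ ⁅v, e i⁆ = ι ℝ ⁅v, x⁆ := by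
    conv_rhs => rw [← he.sum_smul x, lie_sum, map_sum]
    refine Finset.sum_congr rfl fun i _ => ?_
    rw [lie_smul, map_smul, metric_symm]
  have h2 : ∑ i, metric g x ⁅v, e i⁆ • ι ℝ (e i) = -ι ℝ ⁅v, x⁆ := by
    conv_rhs => rw [← he.sum_smul ⁅v, x⁆, map_sum, ← Finset.sum_neg_distrib]
    refine Finset.sum_congr rfl fun i _ => ?_
    rw [map_smul, ← neg_smul, metric_lie_right]
  rw [dOne_eq_sum he, map_smul, map_sum]
  simp only [interior_ι_mul, interior_ι, ← Algebra.commutes, ← Algebra.smul_def,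
    Finset.sum_sub_distrib, h1, h2]
  rw [sub_neg_eq_add, ← two_smul ℝ, smul_smul]
  norm_num

lemma sum_ι_mul_ι_lie (he : IsOrthonormal (metric g) e) (v : g) :
    ∑ i, ι ℝ (e i) * ι ℝ ⁅e i, v⁆ = -(2 : ℝ) • (dOne g v : ExteriorAlgebra ℝ g) := by
  rw [dOne_eq_sum he, smul_smul, show -(2 : ℝ) * (1 / 2) = -1 by norm_num, neg_one_smul,
    ← Finset.sum_neg_distrib]
  refine Finset.sum_congr rfl fun i _ => ?_
  rw [← lie_skew, map_neg, mul_neg]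

/-- Koszul's formula `d = -½ ∑ᵢ eᵢ ∧ L(eᵢ)`. -/
lemma sum_ι_mul_lieDerivative (he : IsOrthonormal (metric g) e) (φ : ExteriorAlgebra ℝ g) :
    ∑ i, ι ℝ (e i) * lieDerivative (e i) φ = -(2 : ℝ) • extDiff φ := by
  induction φ using exterior_induction with
  | h0 r => simp only [lieDerivative_algebraMap, extDiff_algebraMap, mul_zero, smul_zero,
      Finset.sum_const_zero]
  | hadd φ ψ h h' => simp only [map_add, mul_add, Finset.sum_add_distrib, h, h', smul_add]
  | hmul v φ h =>
    have hs : ∀ i, ι ℝ (e i) * lieDerivative (e i) (ι ℝ v * φ) =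
        ι ℝ (e i) * ι ℝ ⁅e i, v⁆ * φ - ι ℝ v * (ι ℝ (e i) * lieDerivative (e i) φ) := fun i => by
      rw [lieDerivative_ι_mul, mul_add, ← mul_assoc, ← mul_assoc, ← mul_assoc,
        eq_neg_of_add_eq_zero_left (ι_add_mul_swap (e i) v), neg_mul, sub_eq_add_neg]
    simp only [hs, Finset.sum_sub_distrib, ← Finset.sum_mul, ← Finset.mul_sum, h,
      sum_ι_mul_ι_lie he, extDiff_ι_mul, smul_sub, smul_mul_assoc, mul_smul_comm]

/-- Cartan's formula; the sign comes from `⟨d v, x ∧ y⟩ = ⟨v, [x, y]⟩`, without a minus sign. -/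
lemma extDiff_interior (he : IsOrthonormal (metric g) e) (x : g) (φ : ExteriorAlgebra ℝ g) :
    extDiff (interior x φ) = -lieDerivative x φ - interior x (extDiff φ) := by
  induction φ using exterior_induction with
  | h0 r => simp only [lieDerivative_algebraMap, extDiff_algebraMap, interior_algebraMap, map_zero,
      neg_zero, sub_zero]
  | hadd φ ψ h h' => simp only [map_add, h, h', neg_add]; abel
  | hmul v φ h =>
    rw [interior_ι_mul, map_sub, map_smul, extDiff_ι_mul, extDiff_ι_mul, h, map_sub,
      interior_two_mul x (dOne g v).2, interior_dOne he, interior_ι_mul, lieDerivative_ι_mul,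
      ← lie_skew x v, map_neg, neg_mul]
    simp only [mul_sub, mul_neg]
    abel

omit [FiniteDimensional ℝ g] [LieAlgebra.IsKilling ℝ g] in
lemma skew_ad (x : g) (a b : g) : metric g a (LieModule.toEnd ℝ g g x b) =
    -metric g b (LieModule.toEnd ℝ g g x a) :=
  metric_lie_right x a b

lemma lieDerivative_dOne (he : IsOrthonormal (metric g) e) (x v : g) :
    lieDerivative x (dOne g v : ExteriorAlgebra ℝ g) = dOne g ⁅x, v⁆ := by
  have h := he.sum_skew ((LinearMap.mul ℝ (ExteriorAlgebra ℝ g)).compl₁₂ (ι ℝ)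
    (ι ℝ ∘ₗ LieModule.toEnd ℝ g g v)) _ (skew_ad x)
  simp only [LinearMap.compl₁₂_apply, LinearMap.comp_apply, LinearMap.mul_apply',
    LieModule.toEnd_apply_apply, Finset.sum_add_distrib] at h
  rw [dOne_eq_sum he, dOne_eq_sum he, map_smul, map_sum]
  simp only [lieDerivative_ι_mul, lieDerivative_ι, Finset.sum_add_distrib,
    eq_neg_of_add_eq_zero_left h, lie_lie, map_sub, mul_sub, Finset.sum_sub_distrib]
  congr 1
  abel

lemma lieDerivative_extDiff (he : IsOrthonormal (metric g) e) (x : g) (φ : ExteriorAlgebra ℝ g) :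
    lieDerivative x (extDiff φ) = extDiff (lieDerivative x φ) := by
  induction φ using exterior_induction with
  | h0 r => simp only [lieDerivative_algebraMap, extDiff_algebraMap, map_zero]
  | hadd φ ψ h h' => simp only [map_add, h, h']
  | hmul v φ h =>
    rw [extDiff_ι_mul, map_sub, lieDerivative_mul, lieDerivative_ι_mul, lieDerivative_ι_mul,
      map_add, extDiff_ι_mul, extDiff_ι_mul, h, lieDerivative_dOne he]
    abel

lemma extDiff_dOne (he : IsOrthonormal (metric g) e) (v : g) :
    extDiff (dOne g v : ExteriorAlgebra ℝ g) = 0 := by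
  have hK := sum_ι_mul_lieDerivative he (dOne g v : ExteriorAlgebra ℝ g)
  have hC := he.sum_skew ((LinearMap.mul ℝ (ExteriorAlgebra ℝ g)).compl₁₂ (ι ℝ)
    ((⋀[ℝ]^2 g).subtype ∘ₗ dOne g)) _ (skew_ad v)
  have hD : (2 : ℝ) • extDiff (dOne g v : ExteriorAlgebra ℝ g) =
      ∑ i, (ι ℝ ⁅v, e i⁆ * (dOne g (e i) : ExteriorAlgebra ℝ g) -
        ι ℝ (e i) * (dOne g ⁅v, e i⁆ : ExteriorAlgebra ℝ g)) := by
    conv_lhs => rw [dOne_eq_sum he, map_smul, smul_smul, map_sum]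
    rw [show (2 : ℝ) * (1 / 2) = 1 by norm_num, one_smul]
    refine Finset.sum_congr rfl fun i _ => ?_
    rw [extDiff_ι_mul, extDiff_ι, two_mul_ι]
  simp only [LinearMap.compl₁₂_apply, LinearMap.comp_apply, LinearMap.mul_apply',
    LieModule.toEnd_apply_apply, Submodule.subtype_apply, Finset.sum_add_distrib] at hC
  have hS : ∑ i, ι ℝ (e i) * (dOne g ⁅v, e i⁆ : ExteriorAlgebra ℝ g) =
      (2 : ℝ) • extDiff (dOne g v : ExteriorAlgebra ℝ g) := by
    rw [← neg_inj, ← Finset.sum_neg_distrib, ← neg_smul, ← hK]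
    refine Finset.sum_congr rfl fun i _ => ?_
    rw [lieDerivative_dOne he, ← lie_skew, map_neg, Submodule.coe_neg, mul_neg, neg_neg]
  rw [Finset.sum_sub_distrib, eq_neg_of_add_eq_zero_left hC, hS] at hD
  have h3 : (6 : ℝ) • extDiff (dOne g v : ExteriorAlgebra ℝ g) = 0 := by
    rw [← sub_eq_zero] at hD
    rw [← hD]
    module
  exact (smul_eq_zero.mp h3).resolve_left (by norm_num)

lemma extDiff_extDiff (he : IsOrthonormal (metric g) e) (φ : ExteriorAlgebra ℝ g) :
    extDiff (extDiff φ) = 0 := by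
  induction φ using exterior_induction with
  | h0 r => rw [extDiff_algebraMap, map_zero]
  | hadd φ ψ h h' => rw [map_add, map_add, h, h', add_zero]
  | hmul v φ h =>
    rw [extDiff_ι_mul, map_sub, extDiff_two_mul (dOne g v).2, extDiff_ι_mul, extDiff_dOne he, h,
      zero_mul, mul_zero, zero_add, sub_zero, sub_self]

lemma sum_dOne_mul_interior (he : IsOrthonormal (metric g) e) (φ : ExteriorAlgebra ℝ g) :
    ∑ i, (dOne g (e i) : ExteriorAlgebra ℝ g) * interior (e i) φ = extDiff φ := by
  induction φ using exterior_induction with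
  | h0 r => simp only [interior_algebraMap, extDiff_algebraMap, mul_zero, Finset.sum_const_zero]
  | hadd φ ψ h h' => simp only [map_add, mul_add, Finset.sum_add_distrib, h, h']
  | hmul v φ h =>
    have hv : ∑ i, metric g (e i) v • ((dOne g (e i) : ExteriorAlgebra ℝ g) * φ) =
        (dOne g v : ExteriorAlgebra ℝ g) * φ := by
      conv_rhs => rw [← he.sum_smul v]
      simp [Finset.sum_mul]
    simp only [interior_ι_mul, mul_sub, Finset.sum_sub_distrib, mul_smul_comm, hv, ← mul_assoc,
      two_mul_ι, extDiff_ι_mul]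
    simp only [mul_assoc, ← Finset.mul_sum, h]

omit [FiniteDimensional ℝ g] [LieAlgebra.IsKilling ℝ g] in
lemma derivationExt_eq_sum (he : IsOrthonormal (metric g) e) (A : Module.End ℝ g)
    (φ : ExteriorAlgebra ℝ g) :
    derivationExt A φ = ∑ i, ι ℝ (A (e i)) * interior (e i) φ := by
  induction φ using exterior_induction with
  | h0 r => simp only [interior_algebraMap, derivationExt_algebraMap, mul_zero,
      Finset.sum_const_zero]
  | hadd φ ψ h h' => simp only [map_add, mul_add, Finset.sum_add_distrib, h, h']
  | hmul v φ h =>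
    have hv : ∑ i, metric g (e i) v • (ι ℝ (A (e i)) * φ) = ι ℝ (A v) * φ := by
      conv_rhs => rw [← he.sum_smul v]
      simp [Finset.sum_mul]
    have hs : ∀ i, ι ℝ (A (e i)) * (ι ℝ v * interior (e i) φ) =
        -(ι ℝ v * (ι ℝ (A (e i)) * interior (e i) φ)) := fun i => by
      rw [← mul_assoc, ← mul_assoc, eq_neg_of_add_eq_zero_left (ι_add_mul_swap (A (e i)) v),
        neg_mul]
    simp only [interior_ι_mul, mul_sub, mul_smul_comm, hs, sub_neg_eq_add,
      Finset.sum_add_distrib, hv, ← Finset.mul_sum, ← h, derivationExt_ι_mul]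

omit [FiniteDimensional ℝ g] [LieAlgebra.IsKilling ℝ g] in
/-- Euler's formula: `∑ᵢ eᵢ ∧ (eᵢ ⌟ φ) = k φ` for `φ` of degree `k`. -/
lemma sum_ι_mul_interior (he : IsOrthonormal (metric g) e) {k : ℕ} {φ : ExteriorAlgebra ℝ g}
    (hφ : φ ∈ ⋀[ℝ]^k g) : ∑ i, ι ℝ (e i) * interior (e i) φ = (k : ℝ) • φ := by
  have h := derivationExt_eq_sum he 1 φ
  simp only [Module.End.one_apply] at h
  rw [← h]
  clear h
  induction k generalizing φ with
  | zero =>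
    obtain ⟨r, rfl⟩ := mem_power_zero hφ
    simp [derivationExt_algebraMap]
  | succ k ih =>
    revert φ
    refine @power_succ_induction _ _ _ _ _ _ _ (fun x y hx hy => ?_) fun v x hx => ?_
    · rw [map_add, hx, hy, smul_add]
    · rw [derivationExt_ι_mul, ih hx, Module.End.one_apply, mul_smul_comm, Nat.cast_succ, add_smul,
        one_smul, add_comm]

/-- Up to a factor, `∑ᵢ eᵢ ⌟ L(eᵢ)` is the adjoint of the differential. -/
lemma extPairing_sum_interior_lieDerivative (he : IsOrthonormal (metric g) e) {k : ℕ}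
    {φ ψ : ExteriorAlgebra ℝ g} (hφ : φ ∈ ⋀[ℝ]^(k + 1) g) (hψ : ψ ∈ ⋀[ℝ]^k g) :
    extPairing (∑ i, interior (e i) (lieDerivative (e i) φ)) ψ =
      2 * extPairing φ (extDiff ψ) := by
  have hs : ∀ i, extPairing (interior (e i) (lieDerivative (e i) φ)) ψ =
      -extPairing φ (ι ℝ (e i) * lieDerivative (e i) ψ) := fun i => by
    rw [extPairing_interior _ (lieDerivative_mem _ hφ) hψ, extPairing_lieDerivative,
      lieDerivative_ι_mul, lie_self, map_zero, zero_mul, zero_add]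
  rw [map_sum, LinearMap.sum_apply]
  simp only [hs, Finset.sum_neg_distrib, ← map_sum, sum_ι_mul_lieDerivative he, map_smul,
    smul_eq_mul, neg_mul, neg_neg]

end Calculus

/-! ### The Cartan form and the bivectors in `g^⊥` -/

section CartanCalculus

open ExteriorAlgebra

lemma exists_ι_eq {R M : Type*} [CommRing R] [AddCommGroup M] [Module R M]
    {x : ExteriorAlgebra R M} (hx : x ∈ ⋀[R]^1 M) : ∃ m, ι R m = x := by
  rw [exteriorPower, pow_one] at hx
  exact hx

variable {g : Type*} [LieRing g] [LieAlgebra ℝ g]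

lemma coe_lie_power {k : ℕ} (x : g) (φ : ⋀[ℝ]^k g) :
    (⁅x, φ⁆ : ⋀[ℝ]^k g) = lieDerivative x (φ : ExteriorAlgebra ℝ g) := rfl

lemma powerMetric_lie {k : ℕ} (x : g) (φ ψ : ⋀[ℝ]^k g) :
    powerMetric g k ⁅x, φ⁆ ψ = -powerMetric g k φ ⁅x, ψ⁆ := by
  rw [← extPairing_eq_powerMetric, ← extPairing_eq_powerMetric, coe_lie_power, coe_lie_power,
    extPairing_lieDerivative]

variable {n : Type*} [Fintype n] [DecidableEq n] {e : Module.Basis n ℝ g}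

/-- The Casimir operator of the metric `-K` is `-1` on `g`. -/
lemma sum_lie_lie (he : IsOrthonormal (metric g) e) (v : g) : ∑ i, ⁅e i, ⁅e i, v⁆⁆ = -v := by
  have key : ∀ w, metric g (∑ i, ⁅e i, ⁅e i, v⁆⁆) w = metric g (-v) w := fun w => by
    have hK : killingForm ℝ g v w = ∑ i, metric g (e i) ⁅v, ⁅w, e i⁆⁆ := by
      rw [killingForm_apply_apply, LinearMap.trace_eq_matrix_trace ℝ e, Matrix.trace]
      refine Finset.sum_congr rfl fun i _ => ?_
      rw [Matrix.diag_apply, LinearMap.toMatrix_apply, ← he.apply_eq_repr]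
      rfl
    have hm : metric g (-v) w = killingForm ℝ g v w := by
      rw [map_neg, LinearMap.neg_apply, metric, LinearMap.neg_apply, LinearMap.neg_apply, neg_neg]
    rw [hm, hK, map_sum, LinearMap.sum_apply]
    refine Finset.sum_congr rfl fun i _ => ?_
    rw [metric_lie, metric_lie_right v (e i), ← lie_skew w (e i), ← lie_skew v (e i)]
    simp only [map_neg, LinearMap.neg_apply, neg_neg]
    rw [metric_symm]
  have h : ∀ x, metric g x (∑ i, ⁅e i, ⁅e i, v⁆⁆) = metric g x (-v) := fun x => by
    rw [metric_symm, key, metric_symm]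
  rw [← he.sum_smul (∑ i, ⁅e i, ⁅e i, v⁆⁆), ← he.sum_smul (-v)]
  simp only [h]

/-- The induced metrics are positive definite. -/
lemma powerMetric_pos (he : IsOrthonormal (metric g) e) {k : ℕ} {φ : ⋀[ℝ]^k g} (hφ : φ ≠ 0) :
    0 < powerMetric g k φ φ := by
  have : FiniteDimensional ℝ g := e.finiteDimensional_of_finite
  obtain ⟨b, hb⟩ := exists_isOrthonormal_basis (metric g) (metric_symm g) fun x hx => he.pos hx
  exact (isOrthonormal_powerMetric hb k).pos hφ

lemma eq_zero_of_powerMetric_self (he : IsOrthonormal (metric g) e) {k : ℕ} {φ : ⋀[ℝ]^k g}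
    (hφ : powerMetric g k φ φ = 0) : φ = 0 := by
  by_contra h
  exact (powerMetric_pos he h).ne' hφ

variable [FiniteDimensional ℝ g] [LieAlgebra.IsKilling ℝ g]

/-- Contracting a vector into the Cartan form gives minus its differential. -/
lemma interior_cartanForm (w : g) :
    interior w (cartanForm g : ExteriorAlgebra ℝ g) = -(dOne g w : ExteriorAlgebra ℝ g) := by
  have h : (⟨_, interior_mem w (cartanForm g).2⟩ : ⋀[ℝ]^2 g) = -dOne g w := by
    refine ext_powerMetric fun v => ?_
    have hv : ι ℝ w * (exteriorPower.ιMulti ℝ 2 v : ExteriorAlgebra ℝ g) =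
        exteriorPower.ιMulti ℝ 3 (Fin.cons w v : Fin 3 → g) := by
      rw [exteriorPower.ιMulti_apply_coe, exteriorPower.ιMulti_apply_coe, ιMulti_cons]
      rfl
    rw [← extPairing_eq_powerMetric, extPairing_interior w (cartanForm g).2 (Subtype.prop _), hv,
      extPairing_eq_powerMetric, cartanForm, powerMetric_sharp,
      exteriorPower.alternatingMapLinearEquiv_apply_ιMulti, map_neg, LinearMap.neg_apply,
      powerMetric_dOne, bracketMap_apply, metric, LinearMap.neg_apply, LinearMap.neg_apply, neg_neg]
    rfl
  exact congrArg Subtype.val h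

/-- The action of a bivector on the Cartan form is its differential. -/
lemma rhoCartan_eq_extDiff (he : IsOrthonormal (metric g) e) (τ : ⋀[ℝ]^2 g) :
    (rhoCartan g τ : ExteriorAlgebra ℝ g) = extDiff (τ : ExteriorAlgebra ℝ g) := by
  have h : (⋀[ℝ]^3 g).subtype ∘ₗ rhoCartan g = extDiff ∘ₗ (⋀[ℝ]^2 g).subtype := by
    apply exteriorPower.linearMap_ext
    ext v
    have hv : v = ![v 0, v 1] := by
      ext i
      fin_cases i <;> rfl
    change derivationExt (bivectorEnd g (exteriorPower.ιMulti ℝ 2 v))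
      (cartanForm g : ExteriorAlgebra ℝ g) =
        extDiff (exteriorPower.ιMulti ℝ 2 v : ExteriorAlgebra ℝ g)
    have hsum : ∀ w : g, ∑ i, metric g w (e i) • interior (e i) (cartanForm g : ExteriorAlgebra ℝ g)
        = -(dOne g w : ExteriorAlgebra ℝ g) := fun w => by
      rw [← interior_cartanForm]
      conv_rhs => rw [← he.sum_smul w, map_sum, LinearMap.sum_apply]
      refine Finset.sum_congr rfl fun i _ => ?_
      rw [map_smul, LinearMap.smul_apply, metric_symm]
    rw [derivationExt_eq_sum he]
    simp only [bivectorEnd_apply, map_sub, map_smul, sub_mul, smul_mul_assoc,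
      Finset.sum_sub_distrib]
    simp only [← mul_smul_comm, ← Finset.mul_sum, hsum]
    rw [hv, coe_ιMulti_two, extDiff_ι_mul, extDiff_ι, two_mul_ι]
    simp only [Matrix.cons_val_zero, Matrix.cons_val_one, mul_neg]
    abel
  exact LinearMap.congr_fun h τ

lemma DPlus_tmul (he : IsOrthonormal (metric g) e) (v : g) (τ : gPerp g) :
    (DPlus g (v ⊗ₜ τ) : ExteriorAlgebra ℝ g) = ι ℝ v * extDiff (τ : ExteriorAlgebra ℝ g) := by
  rw [← rhoCartan_eq_extDiff he]
  rfl

lemma DMinus_tmul (he : IsOrthonormal (metric g) e) (v : g) (τ : gPerp g) :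
    (DMinus g (v ⊗ₜ τ) : ExteriorAlgebra ℝ g) = interior v (extDiff (τ : ExteriorAlgebra ℝ g)) := by
  rw [← rhoCartan_eq_extDiff he]
  rfl

lemma dOne_lie (he : IsOrthonormal (metric g) e) (x v : g) : dOne g ⁅x, v⁆ = ⁅x, dOne g v⁆ :=
  Subtype.ext (lieDerivative_dOne he x v).symm

/-- `δ d = ½` on `g`. -/
lemma bracketMap_dOne (he : IsOrthonormal (metric g) e) (v : g) :
    bracketMap g (dOne g v) = (1 / 2 : ℝ) • v := by
  rw [dOne_eq_sum_ιMulti he, map_smul, map_sum]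
  congr 1
  have h : ∀ i, bracketMap g (exteriorPower.ιMulti ℝ 2 ![e i, ⁅v, e i⁆]) = -⁅e i, ⁅e i, v⁆⁆ :=
    fun i => by
      rw [bracketMap_apply, ← lie_neg, lie_skew]
      rfl
  simp only [h, Finset.sum_neg_distrib, sum_lie_lie he, neg_neg]

/-- The orthogonal projection `τ ↦ τ - 2 d δ τ` of `Λ²(g)` onto `g^⊥ = ker δ`. -/
def gPerpProj (he : IsOrthonormal (metric g) e) : ⋀[ℝ]^2 g →ₗ⁅ℝ,g⁆ gPerp g :=
  { LinearMap.codRestrict (gPerp g).toSubmodule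
      (LinearMap.id - (2 : ℝ) • (dOne g ∘ₗ bracketMap g)) (fun τ => by
        change bracketMap g (τ - (2 : ℝ) • dOne g (bracketMap g τ)) = 0
        rw [map_sub, map_smul, bracketMap_dOne he, smul_smul]
        norm_num) with
    map_lie' := fun {x τ} => Subtype.ext (by
      change ⁅x, τ⁆ - (2 : ℝ) • dOne g (bracketMap g ⁅x, τ⁆) =
        ⁅x, τ - (2 : ℝ) • dOne g (bracketMap g τ)⁆
      rw [bracketMap_lie, dOne_lie he, lie_sub]
      exact congrArg _ (lie_smul (2 : ℝ) x (dOne g (bracketMap g τ))).symm) }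

lemma extDiff_gPerpProj (he : IsOrthonormal (metric g) e) (τ : ⋀[ℝ]^2 g) :
    extDiff ((gPerpProj he τ : ⋀[ℝ]^2 g) : ExteriorAlgebra ℝ g) =
      extDiff (τ : ExteriorAlgebra ℝ g) := by
  change extDiff ((τ : ExteriorAlgebra ℝ g) -
    (2 : ℝ) • (dOne g (bracketMap g τ) : ExteriorAlgebra ℝ g)) = _
  rw [map_sub, map_smul, extDiff_dOne he, smul_zero, sub_zero]

/-- There are no nonzero harmonic bivectors, i.e. `H²(g) = 0`. If `d τ = 0`, then `[x, τ]` is exact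
by Cartan's formula, hence orthogonal to `ker δ`; but it lies in `ker δ` if `τ` does. -/
lemma eq_zero_of_extDiff_eq_zero (he : IsOrthonormal (metric g) e) {τ : ⋀[ℝ]^2 g}
    (hδ : bracketMap g τ = 0) (hd : extDiff (τ : ExteriorAlgebra ℝ g) = 0) : τ = 0 := by
  have hint : ∀ x, interior x (τ : ExteriorAlgebra ℝ g) = 0 := fun x => by
    obtain ⟨y, hy⟩ := exists_ι_eq (interior_mem x τ.2)
    have hL : ⁅x, τ⁆ = -dOne g y := Subtype.ext (by
      rw [coe_lie_power, Submodule.coe_neg, ← extDiff_ι, hy, extDiff_interior he, hd, map_zero,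
        sub_zero, neg_neg])
    have h0 : ⁅x, τ⁆ = 0 := by
      refine eq_zero_of_powerMetric_self he ?_
      refine (congrArg (fun σ => powerMetric g 2 σ ⁅x, τ⁆) hL).trans ?_
      rw [map_neg, LinearMap.neg_apply, powerMetric_dOne, bracketMap_lie, hδ, lie_zero,
        map_zero, neg_zero]
    have hy0 : (1 / 2 : ℝ) • y = 0 := by
      rw [← bracketMap_dOne he, ← neg_eq_zero, ← map_neg, ← hL, h0, map_zero]
    rw [← hy, (smul_eq_zero.mp hy0).resolve_left (by norm_num), map_zero]
  have h := sum_ι_mul_interior he τ.2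
  simp only [hint, mul_zero, Finset.sum_const_zero] at h
  exact Subtype.ext ((smul_eq_zero.mp h.symm).resolve_left (by norm_num))

end CartanCalculus

/-! ### Tensor products of modules over a Lie algebra -/

section TensorModules

variable {L M N Q : Type*} [LieRing L] [LieAlgebra ℝ L] [AddCommGroup M] [Module ℝ M]
  [LieRingModule L M] [LieModule ℝ L M] [AddCommGroup N] [Module ℝ N] [LieRingModule L N]
  [LieModule ℝ L N] [AddCommGroup Q] [Module ℝ Q] [LieRingModule L Q]

lemma map_lie_of_tmul (F : M ⊗[ℝ] N →ₗ[ℝ] Q)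
    (hF : ∀ (x : L) (m : M) (n : N), F (⁅x, m⁆ ⊗ₜ n) + F (m ⊗ₜ ⁅x, n⁆) = ⁅x, F (m ⊗ₜ n)⁆)
    (x : L) (p : M ⊗[ℝ] N) : F ⁅x, p⁆ = ⁅x, F p⁆ := by
  induction p using TensorProduct.induction_on with
  | zero => rw [lie_zero, map_zero, lie_zero]
  | add p q h h' => rw [lie_add, map_add, map_add, h, h', lie_add]
  | tmul m n => rw [TensorProduct.LieModule.lie_tmul_right, map_add, hF]

lemma tmul_invariant {B : LinearMap.BilinForm ℝ M} {C : LinearMap.BilinForm ℝ N}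
    (hB : ∀ (x : L) (m m' : M), B ⁅x, m⁆ m' = -B m ⁅x, m'⁆)
    (hC : ∀ (x : L) (n n' : N), C ⁅x, n⁆ n' = -C n ⁅x, n'⁆) (x : L) (p q : M ⊗[ℝ] N) :
    (B.tmul C) ⁅x, p⁆ q = -(B.tmul C) p ⁅x, q⁆ := by
  induction p using TensorProduct.induction_on with
  | zero => simp
  | add p p' h h' =>
    rw [lie_add, map_add, map_add, LinearMap.add_apply, h, h', LinearMap.add_apply, neg_add]
  | tmul m n =>
    induction q using TensorProduct.induction_on with
    | zero => simp
    | add q q' h h' => rw [lie_add, map_add, map_add, h, h', neg_add]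
    | tmul m' n' =>
      simp only [TensorProduct.LieModule.lie_tmul_right, map_add, LinearMap.add_apply,
        LinearMap.BilinForm.tensorDistrib_tmul, hB, hC, smul_eq_mul]
      ring

end TensorModules

/-! ### Equivariance -/

section Equivariance

open ExteriorAlgebra

variable {g : Type*} [LieRing g] [LieAlgebra ℝ g]

lemma tensorMetric_tmul (v w : g) (τ σ : gPerp g) :
    tensorMetric g (v ⊗ₜ τ) (w ⊗ₜ σ) = metric g v w * powerMetric g 2 τ σ := by
  rw [tensorMetric, LinearMap.BilinForm.tensorDistrib_tmul]
  exact mul_comm _ _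

lemma tensorMetric_symm (p q : g ⊗[ℝ] gPerp g) : tensorMetric g p q = tensorMetric g q p := by
  refine (LinearMap.IsSymm.tmul (B₁ := metric g)
    (B₂ := (powerMetric g 2).restrict (gPerp g).toSubmodule) ⟨fun x y => ?_⟩
    ⟨fun x y => ?_⟩).eq p q
  · exact metric_symm g x y
  · exact powerMetric_symm g 2 x y

lemma tensorMetric_lie (x : g) (p q : g ⊗[ℝ] gPerp g) :
    tensorMetric g ⁅x, p⁆ q = -tensorMetric g p ⁅x, q⁆ := by
  exact tmul_invariant (N := gPerp g) (B := metric g)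
    (C := (powerMetric g 2).restrict (gPerp g).toSubmodule) metric_lie
    (fun x τ σ => powerMetric_lie x τ.1 σ.1) x p q

variable {n : Type*} [Fintype n] [DecidableEq n] {e : Module.Basis n ℝ g}

lemma tensorMetric_pos (he : IsOrthonormal (metric g) e) {p : g ⊗[ℝ] gPerp g} (hp : p ≠ 0) :
    0 < tensorMetric g p p := by
  have : FiniteDimensional ℝ g := e.finiteDimensional_of_finite
  have hpos : ∀ x : gPerp g, x ≠ 0 → 0 < powerMetric g 2 x x := fun x hx =>
    powerMetric_pos he fun h => hx (Subtype.ext h)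
  obtain ⟨f, hf⟩ := exists_isOrthonormal_basis (V := gPerp g)
    ((powerMetric g 2).restrict (gPerp g).toSubmodule)
    (fun x y => powerMetric_symm g 2 x y) hpos
  have hef : IsOrthonormal (tensorMetric g) (e.tensorProduct f) := fun i j => by
    have hf' : powerMetric g 2 (f i.2) (f j.2) = if i.2 = j.2 then 1 else 0 := hf i.2 j.2
    rw [Module.Basis.tensorProduct_apply', Module.Basis.tensorProduct_apply', tensorMetric_tmul,
      he, hf']
    by_cases h1 : i.1 = j.1 <;> by_cases h2 : i.2 = j.2 <;> simp [Prod.ext_iff, h1, h2]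
  exact hef.pos hp

/-- If `Φ : g × N → Q` is bilinear and equivariant, then so is `m ↦ ∑ᵢ eᵢ ⊗ Φ(eᵢ, m)`. -/
def sumTmulHom {N Q : Type*} [AddCommGroup N] [Module ℝ N] [LieRingModule g N] [LieModule ℝ g N]
    [AddCommGroup Q] [Module ℝ Q] [LieRingModule g Q] [LieModule ℝ g Q]
    (he : IsOrthonormal (metric g) e) (Φ : g →ₗ[ℝ] N →ₗ[ℝ] Q)
    (hΦ : ∀ (x v : g) (m : N), ⁅x, Φ v m⁆ = Φ ⁅x, v⁆ m + Φ v ⁅x, m⁆) : N →ₗ⁅ℝ,g⁆ g ⊗[ℝ] Q :=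
  { ∑ i, TensorProduct.mk ℝ g Q (e i) ∘ₗ Φ (e i) with
    map_lie' := fun {x m} => by
      change (∑ i, TensorProduct.mk ℝ g Q (e i) ∘ₗ Φ (e i)) ⁅x, m⁆ =
        ⁅x, (∑ i, TensorProduct.mk ℝ g Q (e i) ∘ₗ Φ (e i)) m⁆
      have h := he.sum_skew ((TensorProduct.mk ℝ g Q).compl₂ (Φ.flip m)) _ (skew_ad x)
      simp only [LinearMap.compl₂_apply, LinearMap.flip_apply, TensorProduct.mk_apply,
        LieModule.toEnd_apply_apply] at h
      simp only [LinearMap.sum_apply, LinearMap.comp_apply, TensorProduct.mk_apply, lie_sum,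
        TensorProduct.LieModule.lie_tmul_right, hΦ, TensorProduct.tmul_add, ← add_assoc]
      rw [Finset.sum_add_distrib, h, zero_add] }

lemma sumTmulHom_apply {N Q : Type*} [AddCommGroup N] [Module ℝ N] [LieRingModule g N]
    [LieModule ℝ g N] [AddCommGroup Q] [Module ℝ Q] [LieRingModule g Q] [LieModule ℝ g Q]
    (he : IsOrthonormal (metric g) e) (Φ : g →ₗ[ℝ] N →ₗ[ℝ] Q)
    (hΦ : ∀ (x v : g) (m : N), ⁅x, Φ v m⁆ = Φ ⁅x, v⁆ m + Φ v ⁅x, m⁆) (m : N) :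
    sumTmulHom he Φ hΦ m = ∑ i, e i ⊗ₜ Φ (e i) m := by
  change (∑ i, TensorProduct.mk ℝ g Q (e i) ∘ₗ Φ (e i)) m = _
  simp

variable [FiniteDimensional ℝ g] [LieAlgebra.IsKilling ℝ g]

lemma DPlus_lie (he : IsOrthonormal (metric g) e) (x : g) (p : g ⊗[ℝ] gPerp g) :
    DPlus g ⁅x, p⁆ = ⁅x, DPlus g p⁆ := by
  refine map_lie_of_tmul _ (fun x v τ => Subtype.ext ?_) x p
  rw [Submodule.coe_add, coe_lie_power, DPlus_tmul he, DPlus_tmul he, DPlus_tmul he,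
    lieDerivative_ι_mul, lieDerivative_extDiff he]
  rfl

lemma DMinus_lie (he : IsOrthonormal (metric g) e) (x : g) (p : g ⊗[ℝ] gPerp g) :
    DMinus g ⁅x, p⁆ = ⁅x, DMinus g p⁆ := by
  refine map_lie_of_tmul _ (fun x v τ => Subtype.ext ?_) x p
  rw [Submodule.coe_add, coe_lie_power, DMinus_tmul he, DMinus_tmul he, DMinus_tmul he,
    lieDerivative_interior, lieDerivative_extDiff he]
  rfl

/-- `(D₋, D₊)` as a homomorphism of `g`-modules. -/
def DMinusPlus (he : IsOrthonormal (metric g) e) :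
    g ⊗[ℝ] gPerp g →ₗ⁅ℝ,g⁆ (⋀[ℝ]^2 g) × (⋀[ℝ]^4 g) :=
  { (DMinus g).prod (DPlus g) with
    map_lie' := fun {x p} => Prod.ext (DMinus_lie he x p) (DPlus_lie he x p) }

/-- `W_har` as a `g`-submodule. -/
def wHarLie (he : IsOrthonormal (metric g) e) : LieSubmodule ℝ g (g ⊗[ℝ] gPerp g) :=
  { wHar g with
    lie_mem := fun {x p} hp => by
      have hp' : DMinusPlus he p = 0 := Prod.ext hp.2 hp.1
      have h : DMinusPlus he ⁅x, p⁆ = 0 := by rw [LieModuleHom.map_lie, hp', lie_zero]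
      exact ⟨congrArg Prod.snd h, congrArg Prod.fst h⟩ }

lemma mem_wHarLie_of_DMinusPlus (he : IsOrthonormal (metric g) e) {p : g ⊗[ℝ] gPerp g}
    (hp : DMinusPlus he p = 0) : p ∈ wHarLie he :=
  ⟨congrArg Prod.snd hp, congrArg Prod.fst hp⟩

/-- A submodule that meets `W_har` trivially embeds into `Λ²(g) ⊕ Λ⁴(g)` by `(D₋, D₊)`. -/
lemma exists_equiv_of_disjoint_wHar (he : IsOrthonormal (metric g) e)
    {V : LieSubmodule ℝ g (g ⊗[ℝ] gPerp g)} (hV : Disjoint V (wHarLie he)) :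
    ∃ U : LieSubmodule ℝ g ((⋀[ℝ]^2 g) × (⋀[ℝ]^4 g)), Nonempty (V ≃ₗ⁅ℝ,g⁆ U) := by
  have hinj : Function.Injective ((DMinusPlus he).comp V.incl) := by
    rw [← LieModuleHom.coe_toLinearMap, ← LinearMap.ker_eq_bot]
    refine LinearMap.ker_eq_bot'.mpr fun p hp => Subtype.ext ?_
    have h : (p : g ⊗[ℝ] gPerp g) ∈ V ⊓ wHarLie he := ⟨p.2, mem_wHarLie_of_DMinusPlus he hp⟩
    rwa [hV.eq_bot] at h
  exact ⟨_, ⟨lieEquivRange _ hinj⟩⟩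

lemma deltaG_lie (he : IsOrthonormal (metric g) e) (k : ℕ) (x : g) (φ : ⋀[ℝ]^(k + 1) g) :
    deltaG g k ⁅x, φ⁆ = ⁅x, deltaG g k φ⁆ := by
  refine ext_powerMetric fun v => ?_
  have h : dG g k ⁅x, exteriorPower.ιMulti ℝ k v⁆ = ⁅x, dG g k (exteriorPower.ιMulti ℝ k v)⁆ :=
    Subtype.ext (lieDerivative_extDiff he x _).symm
  rw [deltaG_adjoint, powerMetric_lie, powerMetric_lie, deltaG_adjoint, h]

/-- `Λ³_δ(g)` as a `g`-submodule. -/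
def lambdaThreeDeltaLie (he : IsOrthonormal (metric g) e) : LieSubmodule ℝ g (⋀[ℝ]^3 g) :=
  { lambdaThreeDelta g with
    lie_mem := by
      rintro x _ ⟨φ, rfl⟩
      exact ⟨⁅x, φ⁆, deltaG_lie he 3 x φ⟩ }

end Equivariance

/-! ### Kernels and images of `D₊` and `D₋` -/

section KernelsImages

open ExteriorAlgebra

variable {g : Type*} [LieRing g] [LieAlgebra ℝ g] [FiniteDimensional ℝ g]
  [LieAlgebra.IsKilling ℝ g] {n : Type*} [Fintype n] [DecidableEq n] {e : Module.Basis n ℝ g}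

lemma DMinus_eq_zero_of_mem (he : IsOrthonormal (metric g) e) {p : g ⊗[ℝ] gPerp g}
    (hp : p ∈ wHarLie he) : DMinus g p = 0 :=
  hp.2

lemma DPlus_eq_zero_of_mem (he : IsOrthonormal (metric g) e) {p : g ⊗[ℝ] gPerp g}
    (hp : p ∈ wHarLie he) : DPlus g p = 0 :=
  hp.1

/-- The homomorphism `g^⊥ → g ⊗ g^⊥`, `τ ↦ ∑ᵢ eᵢ ⊗ [eᵢ, τ]`. -/
def gPerpHom (he : IsOrthonormal (metric g) e) : gPerp g →ₗ⁅ℝ,g⁆ g ⊗[ℝ] gPerp g :=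
  sumTmulHom he (LinearMap.mk₂ ℝ (fun (x : g) (τ : gPerp g) => ⁅x, τ⁆) add_lie smul_lie lie_add
    fun c x τ => lie_smul c x τ) fun x v τ => leibniz_lie x v τ

omit [FiniteDimensional ℝ g] [LieAlgebra.IsKilling ℝ g] in
lemma gPerpHom_apply (he : IsOrthonormal (metric g) e) (τ : gPerp g) :
    gPerpHom he τ = ∑ i, e i ⊗ₜ ⁅e i, τ⁆ :=
  sumTmulHom_apply he _ _ τ

/-- On `τ ↦ ∑ᵢ eᵢ ⊗ [eᵢ, τ]`, the operator `D₊` is `d d` up to a factor, by Koszul's formula. -/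
lemma DPlus_gPerpHom (he : IsOrthonormal (metric g) e) (τ : gPerp g) :
    DPlus g (gPerpHom he τ) = 0 := by
  refine Subtype.ext ?_
  rw [gPerpHom_apply, map_sum, Submodule.coe_sum]
  have h := sum_ι_mul_lieDerivative he (extDiff (τ : ExteriorAlgebra ℝ g))
  rw [extDiff_extDiff he, smul_zero] at h
  refine Eq.trans (Finset.sum_congr rfl fun i _ => ?_) h
  rw [DPlus_tmul he, lieDerivative_extDiff he]
  rfl

/-- On `τ ↦ ∑ᵢ eᵢ ⊗ [eᵢ, τ]`, the operator `D₋` is `δ d` up to a factor. -/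
lemma powerMetric_DMinus_gPerpHom (he : IsOrthonormal (metric g) e) (τ : gPerp g)
    (σ : ⋀[ℝ]^2 g) : powerMetric g 2 (DMinus g (gPerpHom he τ)) σ =
      2 * powerMetric g 3 (dG g 2 τ) (dG g 2 σ) := by
  have h : (DMinus g (gPerpHom he τ) : ExteriorAlgebra ℝ g) = ∑ i, interior (e i)
      (lieDerivative (e i) (dG g 2 τ : ExteriorAlgebra ℝ g)) := by
    rw [gPerpHom_apply, map_sum, Submodule.coe_sum]
    refine Finset.sum_congr rfl fun i _ => ?_
    rw [DMinus_tmul he]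
    exact congrArg _ (lieDerivative_extDiff he (e i) (τ : ExteriorAlgebra ℝ g)).symm
  rw [← extPairing_eq_powerMetric, ← extPairing_eq_powerMetric, h,
    extPairing_sum_interior_lieDerivative he (dG g 2 τ).2 σ.2]
  rfl

lemma eq_zero_of_DMinus_gPerpHom (he : IsOrthonormal (metric g) e) {τ : gPerp g}
    (h : powerMetric g 2 (DMinus g (gPerpHom he τ)) τ = 0) : τ = 0 := by
  rw [powerMetric_DMinus_gPerpHom, mul_eq_zero] at h
  have hd := eq_zero_of_powerMetric_self he (h.resolve_left two_ne_zero)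
  exact Subtype.ext (eq_zero_of_extDiff_eq_zero he τ.2 (congrArg Subtype.val hd))

/-- The homomorphism `Λ³(g) → g ⊗ g^⊥` that sends `φ` to the projection of `∑ᵢ eᵢ ⊗ (eᵢ ⌟ φ)`. -/
def powerThreeHom (he : IsOrthonormal (metric g) e) : ⋀[ℝ]^3 g →ₗ⁅ℝ,g⁆ g ⊗[ℝ] gPerp g :=
  sumTmulHom he (((contract 2).comp (metric g)).compr₂ (gPerpProj he : ⋀[ℝ]^2 g →ₗ[ℝ] gPerp g))
    fun x v φ => by
      change ⁅x, gPerpProj he (contract 2 (metric g v) φ)⁆ =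
        gPerpProj he (contract 2 (metric g ⁅x, v⁆) φ) + gPerpProj he (contract 2 (metric g v) ⁅x, φ⁆)
      rw [← LieModuleHom.map_lie, ← map_add]
      exact congrArg _ (Subtype.ext (lieDerivative_interior x v _))

lemma DPlus_powerThreeHom (he : IsOrthonormal (metric g) e) (φ : ⋀[ℝ]^3 g) :
    DPlus g (powerThreeHom he φ) = -(2 : ℝ) • dG g 3 φ := by
  refine Subtype.ext ?_
  rw [powerThreeHom, sumTmulHom_apply, map_sum, Submodule.coe_sum]
  have h := congrArg extDiff (sum_ι_mul_interior he φ.2)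
  simp only [map_sum, extDiff_ι_mul, Finset.sum_sub_distrib, sum_dOne_mul_interior he, map_smul]
    at h
  have h' : ∑ i, ι ℝ (e i) * extDiff (interior (e i) (φ : ExteriorAlgebra ℝ g)) =
      -(2 : ℝ) • extDiff (φ : ExteriorAlgebra ℝ g) := by
    rw [← sub_sub_self (extDiff (φ : ExteriorAlgebra ℝ g)) (∑ i, _), h]
    push_cast
    module
  refine Eq.trans (Finset.sum_congr rfl fun i _ => ?_) h'
  rw [DPlus_tmul he]
  exact congrArg _ (extDiff_gPerpProj he _)

lemma DMinus_powerThreeHom (he : IsOrthonormal (metric g) e) {φ : ⋀[ℝ]^3 g}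
    (hφ : φ ∈ lambdaThreeDelta g) : DMinus g (powerThreeHom he φ) = 0 := by
  obtain ⟨ψ, rfl⟩ := hφ
  set φ := deltaG g 3 ψ
  have h : (DMinus g (powerThreeHom he φ) : ExteriorAlgebra ℝ g) =
      -∑ i, interior (e i) (lieDerivative (e i) (φ : ExteriorAlgebra ℝ g)) := by
    rw [powerThreeHom, sumTmulHom_apply, map_sum, Submodule.coe_sum, ← Finset.sum_neg_distrib]
    refine Finset.sum_congr rfl fun i _ => ?_
    rw [DMinus_tmul he]
    refine (congrArg (interior (e i)) ((extDiff_gPerpProj he _).trans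
      (extDiff_interior he (e i) (φ : ExteriorAlgebra ℝ g)))).trans ?_
    rw [map_sub, map_neg, interior_interior, sub_zero]
  refine eq_zero_of_powerMetric_self he ?_
  set χ := DMinus g (powerThreeHom he φ)
  have hdd : dG g 3 (dG g 2 χ) = 0 := Subtype.ext (extDiff_extDiff he _)
  have hχ : extPairing (φ : ExteriorAlgebra ℝ g) (extDiff (χ : ExteriorAlgebra ℝ g)) = 0 := by
    have h' := deltaG_adjoint g 3 ψ (dG g 2 χ)
    rw [hdd, map_zero, ← extPairing_eq_powerMetric] at h'
    exact h'
  have h0 := extPairing_sum_interior_lieDerivative he φ.2 χ.2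
  rwa [← neg_neg (∑ i, _), ← h, hχ, mul_zero, map_neg, LinearMap.neg_apply, neg_eq_zero,
    extPairing_eq_powerMetric] at h0

lemma eq_zero_of_DPlus_powerThreeHom (he : IsOrthonormal (metric g) e) {φ : ⋀[ℝ]^3 g}
    (hφ : φ ∈ lambdaThreeDelta g) (h : DPlus g (powerThreeHom he φ) = 0) : φ = 0 := by
  obtain ⟨ψ, rfl⟩ := hφ
  rw [DPlus_powerThreeHom] at h
  refine eq_zero_of_powerMetric_self he ?_
  rw [deltaG_adjoint, (smul_eq_zero.mp h).resolve_left (by norm_num), map_zero]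

/-- The restriction of `powerThreeHom` to `Λ³_δ(g)`. -/
def lambdaThreeDeltaHom (he : IsOrthonormal (metric g) e) :
    lambdaThreeDeltaLie he →ₗ⁅ℝ,g⁆ g ⊗[ℝ] gPerp g :=
  (powerThreeHom he).comp (lambdaThreeDeltaLie he).incl

lemma DMinus_lambdaThreeDeltaHom (he : IsOrthonormal (metric g) e) (φ : lambdaThreeDeltaLie he) :
    DMinus g (lambdaThreeDeltaHom he φ) = 0 :=
  DMinus_powerThreeHom he φ.2

lemma eq_zero_of_lambdaThreeDeltaHom_mem (he : IsOrthonormal (metric g) e)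
    (φ : lambdaThreeDeltaLie he) (h : lambdaThreeDeltaHom he φ ∈ wHarLie he) : φ = 0 :=
  Subtype.ext (eq_zero_of_DPlus_powerThreeHom he φ.2 (DPlus_eq_zero_of_mem he h))

/-- The projection to `g ⊗ g^⊥` of `∑ᵢ eᵢ ⊗ (eᵢ ∧ v)`. -/
def vecTensor (he : IsOrthonormal (metric g) e) (v : g) : g ⊗[ℝ] gPerp g :=
  ∑ i, e i ⊗ₜ gPerpProj he (exteriorPower.ιMulti ℝ 2 ![e i, v])

lemma extDiff_gPerpProj_ιMulti (he : IsOrthonormal (metric g) e) (w v : g) :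
    extDiff ((gPerpProj he (exteriorPower.ιMulti ℝ 2 ![w, v]) : ⋀[ℝ]^2 g) : ExteriorAlgebra ℝ g) =
      (dOne g w : ExteriorAlgebra ℝ g) * ι ℝ v - ι ℝ w * (dOne g v : ExteriorAlgebra ℝ g) := by
  rw [extDiff_gPerpProj, coe_ιMulti_two, extDiff_ι_mul, extDiff_ι]

/-- Since `∑ᵢ eᵢ ∧ d eᵢ = -3 ω`, the operator `D₊` maps `vecTensor v` to `-3 ω ∧ v`. -/
lemma DPlus_vecTensor (he : IsOrthonormal (metric g) e) (v : g) :
    (DPlus g (vecTensor he v) : ExteriorAlgebra ℝ g) =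
      -(3 : ℝ) • ((cartanForm g : ExteriorAlgebra ℝ g) * ι ℝ v) := by
  have hω := sum_ι_mul_interior he (cartanForm g).2
  simp only [interior_cartanForm, mul_neg, Finset.sum_neg_distrib] at hω
  have hs : ∀ i, ι ℝ (e i) * ((dOne g (e i) : ExteriorAlgebra ℝ g) * ι ℝ v -
      ι ℝ (e i) * (dOne g v : ExteriorAlgebra ℝ g)) =
      ι ℝ (e i) * (dOne g (e i) : ExteriorAlgebra ℝ g) * ι ℝ v := fun i => by
    rw [mul_sub, ← mul_assoc, ← mul_assoc, ι_sq_zero, zero_mul, sub_zero]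
  rw [vecTensor, map_sum, Submodule.coe_sum]
  simp only [DPlus_tmul he, extDiff_gPerpProj_ιMulti, hs, ← Finset.sum_mul]
  rw [← neg_neg (∑ i, _), hω, neg_mul, smul_mul_assoc, neg_smul]
  norm_num

lemma DMinus_vecTensor (he : IsOrthonormal (metric g) e) (v : g) :
    DMinus g (vecTensor he v) = (3 - Module.finrank ℝ g : ℝ) • dOne g v := by
  refine Subtype.ext ?_
  have hs : ∀ i, interior (e i) ((dOne g (e i) : ExteriorAlgebra ℝ g) * ι ℝ v -
      ι ℝ (e i) * (dOne g v : ExteriorAlgebra ℝ g)) =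
      metric g (e i) v • (dOne g (e i) : ExteriorAlgebra ℝ g) -
        (dOne g v : ExteriorAlgebra ℝ g) +
          ι ℝ (e i) * interior (e i) (dOne g v : ExteriorAlgebra ℝ g) := fun i => by
    rw [map_sub, interior_two_mul _ (dOne g (e i)).2, interior_dOne he, lie_self, map_zero,
      zero_mul, zero_add, interior_ι, ← Algebra.commutes, ← Algebra.smul_def, interior_ι_mul, he,
      if_pos rfl, one_smul, sub_sub_eq_add_sub, add_sub_right_comm]
  have hv : ∑ i, metric g (e i) v • (dOne g (e i) : ExteriorAlgebra ℝ g) =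
      (dOne g v : ExteriorAlgebra ℝ g) := by
    conv_rhs => rw [← he.sum_smul v]
    simp
  rw [vecTensor, map_sum, Submodule.coe_sum]
  simp only [DMinus_tmul he, extDiff_gPerpProj_ιMulti, hs, Finset.sum_add_distrib,
    Finset.sum_sub_distrib, hv, sum_ι_mul_interior he (dOne g v).2, Finset.sum_const,
    Finset.card_univ, ← Module.finrank_eq_card_basis e, Submodule.coe_smul]
  rw [← Nat.cast_smul_eq_nsmul ℝ]
  push_cast
  module

/-- A bivector orthogonal to the image of `D₋` is orthogonal to all `d v`, hence in `g^⊥`, and is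
then closed; this uses `dim g ≠ 3`. -/
lemma DMinus_surjective (he : IsOrthonormal (metric g) e) (hdim : Module.finrank ℝ g ≠ 3) :
    Function.Surjective (DMinus g) := by
  have hrefl : (powerMetric g 2).IsRefl := fun x y h => by rwa [powerMetric_symm]
  have hc : IsCompl (LinearMap.range (DMinus g))
      ((powerMetric g 2).orthogonal (LinearMap.range (DMinus g))) := by
    refine (LinearMap.BilinForm.isCompl_orthogonal_iff_disjoint hrefl).mpr ?_
    rw [Submodule.disjoint_def]
    exact fun x hx hx' => eq_zero_of_powerMetric_self he (hx' x hx)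
  have horth : (powerMetric g 2).orthogonal (LinearMap.range (DMinus g)) = ⊥ := by
    refine (Submodule.eq_bot_iff _).mpr fun σ hσ => ?_
    have hσ' : ∀ p, powerMetric g 2 (DMinus g p) σ = 0 := fun p => hσ _ ⟨p, rfl⟩
    have hne : (3 - Module.finrank ℝ g : ℝ) ≠ 0 := by
      rw [sub_ne_zero]
      exact_mod_cast hdim.symm
    have hb : bracketMap g σ = 0 := by
      by_contra hb
      refine (he.pos hb).ne' ?_
      have h := hσ' (vecTensor he (bracketMap g σ))
      rw [DMinus_vecTensor, map_smul, LinearMap.smul_apply, powerMetric_dOne] at h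
      exact (smul_eq_zero.mp h).resolve_left hne
    exact congrArg Subtype.val
      (eq_zero_of_DMinus_gPerpHom he (τ := (⟨σ, hb⟩ : gPerp g)) (hσ' _))
  rw [← LinearMap.range_eq_top]
  have h := hc.sup_eq_top
  rwa [horth, sup_bot_eq] at h

lemma cartanWedge_le_range_DPlus (he : IsOrthonormal (metric g) e) :
    cartanWedge g ≤ LinearMap.range (DPlus g) := by
  rintro _ ⟨y, rfl⟩
  obtain ⟨v, hv⟩ := exists_ι_eq y.2
  refine ⟨-(1 / 3 : ℝ) • vecTensor he v, Subtype.ext ?_⟩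
  rw [map_smul, Submodule.coe_smul, DPlus_vecTensor, smul_smul]
  norm_num
  rw [hv]
  rfl

/-- The embedding of `g^⊥` into the orthogonal complement of `W_har` in `ker D₊`. -/
lemma exists_equiv_gPerp (he : IsOrthonormal (metric g) e) :
    ∃ U : LieSubmodule ℝ g (g ⊗[ℝ] gPerp g),
      U.toSubmodule ≤ wHarPerpPlus g ∧ Nonempty (U ≃ₗ⁅ℝ,g⁆ gPerp g) := by
  have hle : (wHarLie he).toSubmodule ≤ LinearMap.ker (DPlus g) := inf_le_left
  refine exists_equiv_le_orthogonal (tensorMetric g) tensorMetric_symm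
    (fun _ => tensorMetric_pos he) tensorMetric_lie (wHarLie he) _ hle (gPerpHom he)
    (DPlus_gPerpHom he) fun τ hτ => ?_
  have h : powerMetric g 2 (DMinus g (gPerpHom he τ)) = 0 :=
    (congrArg _ (DMinus_eq_zero_of_mem he hτ)).trans (map_zero _)
  exact eq_zero_of_DMinus_gPerpHom he (LinearMap.congr_fun h τ.1)

/-- The embedding of `Λ³_δ(g)` into the orthogonal complement of `W_har` in `ker D₋`. -/
lemma exists_equiv_lambdaThreeDelta (he : IsOrthonormal (metric g) e) :
    ∃ U : LieSubmodule ℝ g (g ⊗[ℝ] gPerp g),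
      U.toSubmodule ≤ wHarPerpMinus g ∧ Nonempty (U ≃ₗ⁅ℝ,g⁆ lambdaThreeDeltaLie he) := by
  have hle : (wHarLie he).toSubmodule ≤ LinearMap.ker (DMinus g) := inf_le_right
  exact exists_equiv_le_orthogonal (tensorMetric g) tensorMetric_symm
    (fun _ => tensorMetric_pos he) tensorMetric_lie (wHarLie he) _ hle (lambdaThreeDeltaHom he)
    (DMinus_lambdaThreeDeltaHom he) (eq_zero_of_lambdaThreeDeltaHom_mem he)

/-- Complete reducibility provides irreducible submodules `Vᵢ` complementary to `W_har`; each of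
them meets `W_har = ker (D₋, D₊)` trivially. -/
lemma exists_wHar_decomposition (he : IsOrthonormal (metric g) e) :
    ∃ (m : ℕ) (V : Fin m → LieSubmodule ℝ g (g ⊗[ℝ] gPerp g)),
      (∀ i, LieModule.IsIrreducible ℝ g (V i)) ∧
      (∀ i, ∃ U : LieSubmodule ℝ g ((⋀[ℝ]^2 g) × (⋀[ℝ]^4 g)), Nonempty (V i ≃ₗ⁅ℝ,g⁆ U)) ∧
      DirectSum.IsInternal (fun o : Option (Fin m) =>
        o.elim (wHar g) (fun i => (V i).toSubmodule)) := by
  obtain ⟨m, V, hirr, hdisj, hV⟩ := exists_irreducible_decomposition (tensorMetric g)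
    tensorMetric_symm (fun _ => tensorMetric_pos he) tensorMetric_lie (wHarLie he)
  exact ⟨m, V, hirr, fun i => exists_equiv_of_disjoint_wHar he (hdisj i), hV⟩

end KernelsImages

end CartanForm

end

set_option maxHeartbeats 1000000 in
theorem theorem4p8 (g : Type*) [LieRing g] [LieAlgebra ℝ g] [FiniteDimensional ℝ g]
    [LieAlgebra.IsSimple ℝ g] (hcompact : ∀ x : g, x ≠ 0 → killingForm ℝ g x x < 0)
    (hdim : 8 ≤ Module.finrank ℝ g) :
    ((∃ W : LieSubmodule ℝ g (g ⊗[ℝ] CartanForm.gPerp g), W.toSubmodule = CartanForm.wHar g) ∧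
      ∃ (m : ℕ) (V : Fin m → LieSubmodule ℝ g (g ⊗[ℝ] CartanForm.gPerp g)),
        (∀ i, LieModule.IsIrreducible ℝ g (V i)) ∧
        (∀ i, ∃ U : LieSubmodule ℝ g ((⋀[ℝ]^2 g) × (⋀[ℝ]^4 g)), Nonempty (V i ≃ₗ⁅ℝ,g⁆ U)) ∧
        DirectSum.IsInternal (fun o : Option (Fin m) =>
          o.elim (CartanForm.wHar g) (fun i => (V i).toSubmodule))) ∧
    (∃ U : LieSubmodule ℝ g (g ⊗[ℝ] CartanForm.gPerp g),
      U.toSubmodule ≤ CartanForm.wHarPerpPlus g ∧ Nonempty (U ≃ₗ⁅ℝ,g⁆ CartanForm.gPerp g)) ∧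
    (∃ (U : LieSubmodule ℝ g (g ⊗[ℝ] CartanForm.gPerp g)) (N : LieSubmodule ℝ g (⋀[ℝ]^3 g)),
      N.toSubmodule = CartanForm.lambdaThreeDelta g ∧
      U.toSubmodule ≤ CartanForm.wHarPerpMinus g ∧ Nonempty (U ≃ₗ⁅ℝ,g⁆ N)) ∧
    CartanForm.cartanWedge g ≤ LinearMap.range (CartanForm.DPlus g) ∧
    Function.Surjective (CartanForm.DMinus g) := by
  open CartanForm in
  obtain ⟨e, he⟩ := exists_isOrthonormal_basis (metric g) (metric_symm g) fun x hx => by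
    rw [metric, LinearMap.neg_apply, LinearMap.neg_apply]
    exact neg_pos.mpr (hcompact x hx)
  obtain ⟨U, hU, hUN⟩ := exists_equiv_lambdaThreeDelta he
  exact ⟨⟨⟨wHarLie he, rfl⟩, exists_wHar_decomposition he⟩, exists_equiv_gPerp he,
    ⟨U, lambdaThreeDeltaLie he, rfl, hU, hUN⟩, cartanWedge_le_range_DPlus he,
    DMinus_surjective he (by omega)⟩
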